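/- Let $Q$ be $\mathbb{Q}$ or $\mathbb{F}_q(t)$ ($\mathbb{F}_q$ any finite field), let $\infty$ be its place at infinity, fix a separable closure $\bar Q$ of $Q$ and an inertia subgroup $I_\infty\subset \mathrm{Gal}(\bar Q/Q)$ for $\infty$ (at an archimedean place the inertia group is the decomposition group), and let $G$ be a finite group. Write $G\wr S_2=(G\times G)\rtimes S_2$, where the generator $\sigma$ of $S_2$ switches the two factors. A subgroup $G'\subseteq G\wr S_2$ with projection $\pi\colon G'\to S_2$ is called admissible if (i) $(1,\sigma)\in G'$, (ii) $\ker\pi$ surjects onto the first factor of $G\times G$, and (iii) $G'$ is generated by its elements of order $2$ with non-trivial image in $S_2$. A quadratic extension $K\subset\bar Q$ of $Q$ is called real if $\infty$ splits completely in $K$. It is called imaginary if, for $Q=\mathbb{Q}$, it has no real embedding, and, for $Q=\mathbb{F}_q(t)$, it is ramified at $\infty$ and its completion at $\infty$ is isomorphic, as an extension of $\mathbb{F}_q((t^{-1}))$, to the completion of $\mathbb{F}_q(\sqrt t)$ at infinity. Let $K^{\mathrm{un},\infty}\subset\bar Q$ be the maximal extension of $K$ that is unramified everywhere and split completely over $\infty$,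 and let $G_K^{\mathrm{un},\infty}=\mathrm{Gal}(K^{\mathrm{un},\infty}/K)$. Let $\rho\colon G_K^{\mathrm{un},\infty}\to G$ be a continuous surjective homomorphism, let $L$ be the fixed field of $\ker\rho$, so that $\rho$ induces an isomorphism $\mathrm{Gal}(L/K)\cong G$, and let $\tilde L\subset\bar Q$ be the Galois closure of $L$ over $Q$. A twist for $\rho$ is an element $y$ of order $2$ of $\mathrm{Gal}(\tilde L/Q)\setminus\mathrm{Gal}(\tilde L/K)$. For a twist $y$ let $\phi_{\rho,y}\colon\mathrm{Gal}(\tilde L/Q)\to G\wr S_2$ be the homomorphism with $\phi_{\rho,y}(x)=(\rho(x|_L),\rho((yxy^{-1})|_L))$ for $x\in\mathrm{Gal}(\tilde L/K)$ and $\phi_{\rho,y}(y)=(1,\sigma)$. If $K$ is real, the pair $(\rho,y)$ is said to have type $G'$ if the image of $\phi_{\rho,y}$ is $G'$. If $K$ is imaginary, $\rho$ is said to have type $G'$ if the image of $\phi_{\rho,y}$ is $G'$ for $y$ the non-trivial element of the image of $I_\infty$ in $\mathrm{Gal}(\tilde L/Q)$ (which has order $2$ and is a twist). Let $G'\subseteq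 G\wr S_2$ be a subgroup. If there are a quadratic extension $K\subset\bar Q$ of $Q$ and a continuous surjection $\rho\colon G_K^{\mathrm{un},\infty}\to G$ such that either $K$ is imaginary and $\rho$ has type $G'$, or $K$ is real and $(\rho,y)$ has type $G'$ for some twist $y$ for $\rho$, then $G'$ is admissible. -/

import Mathlib

open scoped TensorProduct

noncomputable section

namespace QuadType

universe u v

/-! ### The wreath product `G ≀ S₂` and admissible subgroups -/

/-- The wreath product `G ≀ S₂ = G² ⋊ S₂`, where `S₂` permutes the two factors. -/
abbrev Wreath (G : Type u) [Group G] : Type u :=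
  (Fin 2 → G) ⋊[(mulAutArrow : Equiv.Perm (Fin 2) →* MulAut (Fin 2 → G))] Equiv.Perm (Fin 2)

/-- The element `(1, σ)` of `G ≀ S₂`, where `σ` generates `S₂`. -/
def sigma (G : Type u) [Group G] : Wreath G := SemidirectProduct.inr (Equiv.swap 0 1)

/-- The element `(a, b; 1)` of `G ≀ S₂`. -/
def pair {G : Type u} [Group G] (a b : G) : Wreath G := SemidirectProduct.inl ![a, b]

/-- `G'` is admissible: it contains `(1, σ)`, the kernel of the projection `G' → S₂` surjects onto
the first factor of `G`, and `G'` is generated by its elements of order `2` that have non-trivial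
image in `S₂`. -/
structure IsAdmissible {G : Type u} [Group G] (G' : Subgroup (Wreath G)) : Prop where
  sigma_mem : sigma G ∈ G'
  ker_surj : ∀ g : G, ∃ x ∈ G', x.right = 1 ∧ x.left 0 = g
  generated : Subgroup.closure {x : Wreath G | x ∈ G' ∧ orderOf x = 2 ∧ x.right ≠ 1} = G'

lemma pair_mul {G : Type u} [Group G] (a b c d : G) :
    pair a b * pair c d = pair (a * c) (b * d) := by
  rw [pair, pair, pair, ← map_mul]
  congr 1
  ext i; fin_cases i <;> rfl

lemma sigma_mul_pair {G : Type u} [Group G] (a b : G) :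
    sigma G * pair a b = pair b a * sigma G := by
  refine SemidirectProduct.ext ?_ ?_
  · rw [SemidirectProduct.mul_left, SemidirectProduct.mul_left]
    ext i; fin_cases i <;> simp [sigma, pair] <;> rfl
  · simp [sigma, pair]

lemma sigma_mul_sigma {G : Type u} [Group G] : sigma G * sigma G = 1 := by
  rw [sigma, ← map_mul, Equiv.swap_mul_self, map_one]

open scoped Classical in
/-- Let `N ≤ Γ` have index two, let `r : N → G` be a homomorphism and let `y ∈ Γ ∖ N` have
order two.  This is the homomorphism `φ : Γ → G ≀ S₂` with `φ x = (r x, r (y x y⁻¹); 1)` for `x ∈ N`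
and `φ y = (1, σ)`; an element outside of `N` is written as `x = (x y) y` (note `y = y⁻¹`). -/
def wreathHom {Γ : Type v} {G : Type u} [Group Γ] [Group G] (N : Subgroup Γ) (hN : N.index = 2)
    (r : N →* G) (y : Γ) (hyN : y ∉ N) (hy : orderOf y = 2) : Γ →* Wreath G where
  toFun x :=
    if hx : x ∈ N then
      pair (r ⟨x, hx⟩)
        (r ⟨y * x * y⁻¹, (Subgroup.normal_of_index_eq_two hN).conj_mem x hx y⟩)
    else
      pair (r ⟨x * y, (Subgroup.mul_mem_iff_of_index_two hN).2 (by simp [hx, hyN])⟩)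
        (r ⟨y * x, (Subgroup.mul_mem_iff_of_index_two hN).2 (by simp [hx, hyN])⟩) * sigma G
  map_one' := by
    have h1 : r ⟨y * 1 * y⁻¹, (Subgroup.normal_of_index_eq_two hN).conj_mem 1 N.one_mem y⟩ = 1 := by
      rw [← map_one r]; congr 1; ext; simp
    have h2 : r ⟨1, N.one_mem⟩ = 1 := map_one r
    rw [dif_pos N.one_mem, h1, h2, pair, ← map_one SemidirectProduct.inl]
    congr 1
    ext i; fin_cases i <;> rfl
  map_mul' a b := by
    have hyy : y * y = 1 := by rw [← sq, ← hy]; exact pow_orderOf_eq_one y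
    have hyi : y⁻¹ = y := inv_eq_of_mul_eq_one_left hyy
    have key : ∀ z, y * (y * z) = z := fun z => by rw [← mul_assoc, hyy, one_mul]
    by_cases ha : a ∈ N <;> by_cases hb : b ∈ N
    · have hab : a * b ∈ N := N.mul_mem ha hb
      rw [dif_pos ha, dif_pos hb, dif_pos hab, pair_mul, ← map_mul, ← map_mul]
      congr 2
      ext; simp [mul_assoc]
    · have hab : a * b ∉ N := by simp [Subgroup.mul_mem_iff_of_index_two hN, ha, hb]
      rw [dif_pos ha, dif_neg hb, dif_neg hab, ← mul_assoc (pair _ _) (pair _ _), pair_mul,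
        ← map_mul, ← map_mul]
      congr 3 <;> ext <;> simp [mul_assoc]
    · have hab : a * b ∉ N := by simp [Subgroup.mul_mem_iff_of_index_two hN, ha, hb]
      rw [dif_neg ha, dif_pos hb, dif_neg hab, mul_assoc (pair _ _) (sigma G), sigma_mul_pair,
        ← mul_assoc (pair _ _) (pair _ _), pair_mul,
        ← map_mul, ← map_mul]
      congr 3 <;> ext <;> simp [mul_assoc, hyi, key]
    · have hab : a * b ∈ N := by simp [Subgroup.mul_mem_iff_of_index_two hN, ha, hb]
      rw [dif_neg ha, dif_neg hb, dif_pos hab, mul_assoc (pair _ _) (sigma G), ← mul_assoc (sigma G),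
        sigma_mul_pair, mul_assoc (pair _ _) (sigma G), sigma_mul_sigma, mul_one, pair_mul,
        ← map_mul, ← map_mul]
      congr 2 <;> ext <;> simp [mul_assoc, hyi, key]

/-! ### Places, decomposition and inertia groups -/

/-- The places of an algebraic extension of `ℚ` or of `𝔽_q(t)`: a non-archimedean place is given by
its valuation ring, an archimedean one by an embedding into `ℂ` up to complex conjugation. -/
inductive Place (E : Type u) [Field E] : Type u
  | nonarch (A : ValuationSubring E) (hA : A ≠ ⊤)
  | arch (w : NumberField.InfinitePlace E)

namespace Place

/-- The place `w` of `E` lies over the place `v` of the subfield `F`. -/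
def LiesOver {F : Type u} {E : Type v} [Field F] [Field E] [Algebra F E] :
    Place E → Place F → Prop
  | nonarch A _, nonarch B _ => A.comap (algebraMap F E) = B
  | arch w, arch v => w.comap (algebraMap F E) = v
  | _, _ => False

/-- The decomposition group in `Gal(E/F)` of a place of `E`. -/
def decompositionGroup (F : Type u) {E : Type v} [Field F] [Field E] [Algebra F E] :
    Place E → Subgroup Gal(E/F)
  | nonarch A _ => A.decompositionSubgroup F
  | arch w => MulAction.stabilizer Gal(E/F) w

/-- The inertia group in `Gal(E/F)` of a place of `E`; at an archimedean place it is the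
decomposition group. -/
def inertiaGroup (F : Type u) {E : Type v} [Field F] [Field E] [Algebra F E] :
    Place E → Subgroup Gal(E/F)
  | nonarch A _ => (A.inertiaSubgroup F).map (A.decompositionSubgroup F).subtype
  | arch w => MulAction.stabilizer Gal(E/F) w

end Place

/-- The Galois extension `E/F` is unramified at all places. -/
def IsUnramifiedEverywhere (F : Type u) (E : Type v) [Field F] [Field E] [Algebra F E] : Prop :=
  ∀ w : Place E, w.inertiaGroup F = ⊥

/-- The Galois extension `E/F` is split completely at all places over the place `v` of the
subfield `Q` of `F`. -/
def SplitsCompletelyOver {Q : Type u} [Field Q] (vinf : Place Q) (F : Type u) (E : Type v)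
    [Field F] [Field E] [Algebra F E] [Algebra Q E] : Prop :=
  ∀ w : Place E, w.LiesOver vinf → w.decompositionGroup F = ⊥

/-! ### Quadratic extensions and their maximal unramified extensions -/

section Setup

variable {Q : Type u} [Field Q]

/-- The finite Galois extensions of `K` in the separable closure of `Q` which are unramified
everywhere and split completely over the place `vinf` of `Q`. -/
def unramifiedExtensions (vinf : Place Q) (K : IntermediateField Q (SeparableClosure Q)) :
    Set (IntermediateField K (SeparableClosure Q)) :=
  {E | FiniteDimensional K E ∧ IsGalois K E ∧ IsUnramifiedEverywhere K E ∧
    SplitsCompletelyOver vinf K E}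

/-- `K^{un,∞}`: the maximal unramified extension of `K` inside of the separable closure of `Q`
that is split completely over `vinf`.  As the Galois closure over `K` of an unramified and split
extension is again unramified and split, it is the compositum of all finite Galois ones. -/
def maxUnram (vinf : Place Q) (K : IntermediateField Q (SeparableClosure Q)) :
    IntermediateField K (SeparableClosure Q) :=
  ⨆ E : unramifiedExtensions vinf K, (E : IntermediateField K (SeparableClosure Q))

instance maxUnram_isGalois (vinf : Place Q) (K : IntermediateField Q (SeparableClosure Q)) :
    IsGalois K (maxUnram vinf K) := by
  have : Normal K (maxUnram vinf K) := by
    have h : ∀ E : unramifiedExtensions vinf K,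
        Normal K (E : IntermediateField K (SeparableClosure Q)) := fun E => by
      have := E.2.2.1
      infer_instance
    exact IntermediateField.normal_iSup K (SeparableClosure Q)
      (fun E : unramifiedExtensions vinf K => (E : IntermediateField K (SeparableClosure Q)))
  exact ⟨⟩

/-- `G_K^{un,∞}`, the Galois group of the maximal unramified extension of `K` that is split
completely over `vinf`, with its Krull topology. -/
abbrev GalUnram (vinf : Place Q) (K : IntermediateField Q (SeparableClosure Q)) : Type u :=
  Gal(maxUnram vinf K/K)

variable {vinf : Place Q} {K : IntermediateField Q (SeparableClosure Q)}
variable {G : Type v} [Group G] [TopologicalSpace G]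

/-- The extension `L` of `K` in `K^{un,∞}` that corresponds to `ρ`. -/
def fieldOf (ρ : GalUnram vinf K →ₜ* G) : IntermediateField K (SeparableClosure Q) :=
  IntermediateField.lift (IntermediateField.fixedField (MonoidHom.ker (ρ : GalUnram vinf K →* G)))

/-- The Galois closure `L̃` of `L` over `Q`. -/
def closureOf (ρ : GalUnram vinf K →ₜ* G) : IntermediateField Q (SeparableClosure Q) :=
  IntermediateField.normalClosure Q ((fieldOf ρ).restrictScalars Q) (SeparableClosure Q)

lemma fieldOf_le (ρ : GalUnram vinf K →ₜ* G) :
    (fieldOf ρ).restrictScalars Q ≤ closureOf ρ :=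
  IntermediateField.le_normalClosure _

lemma base_le (ρ : GalUnram vinf K →ₜ* G) : K ≤ closureOf ρ := fun x hx =>
  fieldOf_le ρ ((fieldOf ρ).algebraMap_mem ⟨x, hx⟩)

instance closureOf_isGalois (ρ : GalUnram vinf K →ₜ* G) : IsGalois Q (closureOf ρ) := by
  have : Normal Q (closureOf ρ) := by unfold closureOf; infer_instance
  exact ⟨⟩

/-- `Gal(L̃/K)` as a subgroup of `Gal(L̃/Q)`. -/
def kerSubgroup (ρ : GalUnram vinf K →ₜ* G) : Subgroup Gal(closureOf ρ/Q) :=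
  (IntermediateField.restrict (base_le ρ)).fixingSubgroup

lemma kerSubgroup_index (hK : Module.finrank Q K = 2) (ρ : GalUnram vinf K →ₜ* G) :
    (kerSubgroup ρ).index = 2 := by
  rw [kerSubgroup, ← IntermediateField.finrank_eq_fixingSubgroup_index, ← hK]
  exact (IntermediateField.restrictAlgEquiv (base_le ρ)).toLinearEquiv.finrank_eq.symm

/-- `ρ` inflated to the absolute Galois group of `K`. -/
def inflate (ρ : GalUnram vinf K →ₜ* G) : Gal(SeparableClosure Q/K) →* G :=
  (ρ : GalUnram vinf K →* G).comp (AlgEquiv.restrictNormalHom (maxUnram vinf K))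

lemma inflate_eq_one [DiscreteTopology G] (ρ : GalUnram vinf K →ₜ* G)
    (g : Gal(SeparableClosure Q/K))
    (hg : ∀ z ∈ fieldOf ρ, g z = z) : inflate ρ g = 1 := by
  let H : ClosedSubgroup (GalUnram vinf K) :=
    ⟨MonoidHom.ker (ρ : GalUnram vinf K →* G), by
      have : IsClosed (ρ ⁻¹' {1}) := (isClosed_discrete _).preimage ρ.continuous_toFun
      exact this⟩
  have h := InfiniteGalois.fixingSubgroup_fixedField H
  have hm : AlgEquiv.restrictNormalHom (maxUnram vinf K) g ∈ H.1 := by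
    rw [← h, IntermediateField.mem_fixingSubgroup_iff]
    intro x hx
    apply Subtype.ext
    rw [AlgEquiv.restrictNormalHom_apply]
    exact hg _ ((IntermediateField.mem_lift x).2 hx)
  exact hm

lemma exists_lift (ρ : GalUnram vinf K →ₜ* G) (x : kerSubgroup ρ) :
    ∃ g : Gal(SeparableClosure Q/K), ∀ z : closureOf ρ, g z = (x.1 z : SeparableClosure Q) := by
  obtain ⟨g, hg⟩ := AlgEquiv.restrictNormalHom_surjective (F := Q) (K₁ := closureOf ρ)
    (SeparableClosure Q) x.1
  have hgz : ∀ z : closureOf ρ, g z = (x.1 z : SeparableClosure Q) := fun z => by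
    rw [← hg, AlgEquiv.restrictNormalHom_apply]
  refine ⟨AlgEquiv.ofRingEquiv (f := g.toRingEquiv) fun k => ?_, hgz⟩
  have h1 := hgz ⟨k, base_le ρ k.2⟩
  have h2 := (IntermediateField.mem_fixingSubgroup_iff _ _).1 x.2 ⟨k, base_le ρ k.2⟩
    ((IntermediateField.mem_restrict (base_le ρ) _).2 k.2)
  rw [h2] at h1
  exact h1

lemma inflate_congr [DiscreteTopology G] (ρ : GalUnram vinf K →ₜ* G)
    (g h : Gal(SeparableClosure Q/K))
    (hgh : ∀ z ∈ closureOf ρ, g z = h z) : inflate ρ g = inflate ρ h := by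
  have : inflate ρ (h⁻¹ * g) = 1 := inflate_eq_one ρ _ fun z hz => by
    rw [AlgEquiv.mul_apply, hgh z (fieldOf_le ρ hz)]
    exact h.symm_apply_apply z
  rw [map_mul, map_inv, inv_mul_eq_one] at this
  exact this.symm

/-- The homomorphism `Gal(L̃/K) → Gal(L/K) → G`, whose second arrow is induced by `ρ`: it sends `x`
to the value of `ρ` on the restriction to `K^{un,∞}` of an arbitrary extension of `x`. -/
def projHom [DiscreteTopology G] (ρ : GalUnram vinf K →ₜ* G) : kerSubgroup ρ →* G :=
  MonoidHom.mk' (fun x => inflate ρ (exists_lift ρ x).choose) fun a b => by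
    rw [← map_mul]
    refine inflate_congr ρ _ _ fun z hz => ?_
    rw [AlgEquiv.mul_apply, (exists_lift ρ (a * b)).choose_spec ⟨z, hz⟩,
      (exists_lift ρ b).choose_spec ⟨z, hz⟩, (exists_lift ρ a).choose_spec]
    rfl

/-- `y` is a twist for `ρ`: an element of order two of `Gal(L̃/Q) ∖ Gal(L̃/K)`. -/
def IsTwist (ρ : GalUnram vinf K →ₜ* G) (y : Gal(closureOf ρ/Q)) : Prop :=
  y ∉ kerSubgroup ρ ∧ orderOf y = 2

/-- The homomorphism `Gal(L̃/Q) → G ≀ S₂` associated with `ρ` and `y`. -/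
def typeHom [DiscreteTopology G] (hK : Module.finrank Q K = 2) (ρ : GalUnram vinf K →ₜ* G)
    (y : Gal(closureOf ρ/Q)) (hy : IsTwist ρ y) : Gal(closureOf ρ/Q) →* Wreath G :=
  wreathHom (kerSubgroup ρ) (kerSubgroup_index hK ρ) (projHom ρ) y hy.1 hy.2

/-- The image of the homomorphism associated with `ρ` and the twist `y` is `G'`. -/
def PairHasType [DiscreteTopology G] (hK : Module.finrank Q K = 2) (ρ : GalUnram vinf K →ₜ* G)
    (y : Gal(closureOf ρ/Q)) (G' : Subgroup (Wreath G)) : Prop :=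
  ∃ hy : IsTwist ρ y, (typeHom hK ρ y hy).range = G'

/-- `ρ` has type `G'`, for an imaginary quadratic `K`: the pair `(ρ, y)` gives `G'`, where `y` is the
non-trivial element of the inertia group in `Gal(L̃/Q)` over the place at infinity.  The inertia
group is the image of the inertia group in the absolute Galois group of `Q` of a fixed place
`winf`. -/
def HasType [DiscreteTopology G] (winf : Place (SeparableClosure Q)) (hK : Module.finrank Q K = 2)
    (ρ : GalUnram vinf K →ₜ* G) (G' : Subgroup (Wreath G)) : Prop :=
  ∃ y ∈ (winf.inertiaGroup Q).map (AlgEquiv.restrictNormalHom (closureOf ρ)),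
    y ≠ 1 ∧ PairHasType hK ρ y G'

/-- `K/Q` is real: it is split completely at `vinf`. -/
def IsRealQuadratic (vinf : Place Q) (K : IntermediateField Q (SeparableClosure Q)) : Prop :=
  SplitsCompletelyOver vinf Q K

end Setup

/-! ### The two base fields -/

/-- The place at infinity of `ℚ`. -/
def ratInfty : Place ℚ := Place.arch Rat.infinitePlace

/-- The quadratic field `K` is imaginary: it has no real embedding. -/
def IsImaginaryRat (K : IntermediateField ℚ (SeparableClosure ℚ)) : Prop :=
  NumberField.IsTotallyComplex K

section FunctionField

variable (F : Type u) [Field F]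

open scoped Classical in
/-- The place at infinity of `F(t)`. -/
def ratFuncInfty : Place (RatFunc F) :=
  Place.nonarch (RatFunc.inftyValuation F).valuationSubring fun h => by
    have hX : (RatFunc.X : RatFunc F) ∈ (RatFunc.inftyValuation F).valuationSubring := by
      rw [h]; trivial
    rw [Valuation.mem_valuationSubring_iff, RatFunc.inftyValuation.X] at hX
    exact absurd hX (by rw [← WithZero.exp_zero, WithZero.exp_le_exp]; norm_num)

open scoped Classical in
/-- The completion `F((t⁻¹))` of `F(t)` at infinity. -/
abbrev LocalField : Type u := RatFunc.CompletionAtInfty F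

/-- The field `F(√t)`. -/
abbrev SqrtField : Type u :=
  AdjoinRoot (Polynomial.X ^ 2 - Polynomial.C (RatFunc.X : RatFunc F))

open scoped Classical in
/-- `K/F(t)` is imaginary quadratic: it is ramified at infinity, and its completion at infinity is
isomorphic, as an extension of `F((t⁻¹))`, to the completion of `F(√t)` at infinity.  The completion
of `E` at infinity is taken in the form `F((t⁻¹)) ⊗ E` (the product of the completions of `E` at the
places over infinity). -/
def IsImaginaryRatFunc (K : IntermediateField (RatFunc F) (SeparableClosure (RatFunc F))) : Prop :=
  (∀ w : Place K, w.LiesOver (ratFuncInfty F) → w.inertiaGroup (RatFunc F) ≠ ⊥) ∧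
    Nonempty ((LocalField F ⊗[RatFunc F] K) ≃ₐ[LocalField F]
      (LocalField F ⊗[RatFunc F] SqrtField F))

end FunctionField

end QuadType

end

namespace QuadType

universe u v

/-! The element (1, σ) is the image of the twist, and surjectivity onto the first factor comes from
surjectivity of ρ. The substance is generation: it suffices that Gal(L̃/Q) is generated by its
involutions outside Gal(L̃/K), because these map to elements of order 2 with non-trivial image in S₂
(`isAdmissible_range_wreathHom`).

Let H be the subgroup generated by these involutions; it is normal. Choose a finite Galois F/Q
containing L̃ together with finitely many unramified split extensions of K whose compositum contains
L. The local subgroups of Gal(F/Q) are the inertia groups of the non-archimedean places and the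
decomposition groups of those over ∞. If an element g of a local subgroup fixes K, then it acts on
each of the chosen extensions through a trivial inertia or decomposition group, so it fixes L;
applied to the conjugates of g, this shows that g fixes L̃. If g does not fix K, then g² does, so g
restricts to an involution outside Gal(L̃/K). In both cases g restricts into H
(`closure_twists_eq_top`).

It remains to see that a normal subgroup S of Gal(F/Q) containing all local subgroups is everything,
that is, that its fixed field M is Q. Over ℚ this is Minkowski's theorem. Over k(t) the field M is
unramified at the finite places and split at infinity, and `IsSplitAtInfty.finrank_eq_one` applies.
Its proof is lattice reduction. Unramifiedness makes the matrix of conjugates of a k[t]-basis of the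
integral closure invertible. Among the families with invertible conjugate matrix, take one of least
total pole order at infinity. Minimality makes the matrix, rescaled by the pole orders, invertible
at infinity as well; comparing determinants, all pole orders vanish. The family then consists of
constants, so the rows of its conjugate matrix coincide and the Galois group is trivial. -/

/-! ### Decomposition and inertia groups in terms of valuation rings -/

open scoped Pointwise in
lemma Place.mem_decompositionGroup_nonarch {F : Type u} {E : Type v} [Field F] [Field E]
    [Algebra F E] {A : ValuationSubring E} {hA : A ≠ ⊤} {g : Gal(E/F)} :
    g ∈ (Place.nonarch A hA).decompositionGroup F ↔ ∀ x, g x ∈ A ↔ x ∈ A := by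
  change g ∈ MulAction.stabilizer Gal(E/F) A ↔ _
  rw [MulAction.mem_stabilizer_iff]
  constructor
  · intro h x
    conv_lhs => rw [← h]
    exact ValuationSubring.smul_mem_pointwise_smul_iff (g := g)
  · intro h
    ext x
    rw [ValuationSubring.mem_pointwise_smul_iff_inv_smul_mem]
    rw [← h]
    change g (g.symm x) ∈ A ↔ _
    rw [g.apply_symm_apply]

-- The congruence on `A` already forces `g` to stabilize `A`: if `x ∉ A`, then `x⁻¹` lies in the
-- maximal ideal, hence so does `g x⁻¹`, and `g x ∉ A`.
open scoped Pointwise in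
lemma Place.mem_inertiaGroup_nonarch {F : Type u} {E : Type v} [Field F] [Field E]
    [Algebra F E] {A : ValuationSubring E} {hA : A ≠ ⊤} {g : Gal(E/F)} :
    g ∈ (Place.nonarch A hA).inertiaGroup F ↔ ∀ x ∈ A, g x - x ∈ A.nonunits := by
  change g ∈ (A.inertiaSubgroup F).map (A.decompositionSubgroup F).subtype ↔ _
  constructor
  · rintro ⟨⟨h, hd⟩, hi, rfl⟩ x hx
    have h1 := RingEquiv.congr_fun (MonoidHom.mem_ker.1 hi) (IsLocalRing.residue A ⟨x, hx⟩)
    have h2 : IsLocalRing.residue A ((⟨h, hd⟩ : A.decompositionSubgroup F) • (⟨x, hx⟩ : A)) =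
        IsLocalRing.residue A ⟨x, hx⟩ := h1
    rw [← sub_eq_zero, ← map_sub, IsLocalRing.residue_eq_zero_iff] at h2
    exact ValuationSubring.coe_mem_nonunits_iff.2 h2
  · intro h
    have h1 : ∀ x ∈ A, g x ∈ A := fun x hx => by
      simpa using A.add_mem _ _ (A.nonunits_subset (h x hx)) hx
    have hd : g ∈ (Place.nonarch A hA).decompositionGroup F := by
      rw [Place.mem_decompositionGroup_nonarch]
      refine fun x => ⟨fun hx => ?_, h1 x⟩
      by_contra hx'
      have h2 : x⁻¹ ∈ A := (A.mem_or_inv_mem x).resolve_left hx'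
      have h3 : x⁻¹ ∈ A.nonunits := (A.inv_mem_nonunits_iff).2 (.inr hx')
      have h4 : g x⁻¹ ∈ A.nonunits := by
        simpa using A.nonunits.add_mem (h _ h2) h3
      rw [map_inv₀, ValuationSubring.inv_mem_nonunits_iff] at h4
      rcases h4 with h4 | h4
      · exact hx' (by rw [(map_eq_zero g).1 h4]; exact A.zero_mem)
      · exact h4 hx
    refine ⟨⟨g, hd⟩, ?_, rfl⟩
    refine MonoidHom.mem_ker.2 (RingEquiv.ext fun y => ?_)
    obtain ⟨⟨x, hx⟩, rfl⟩ := IsLocalRing.residue_surjective y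
    change IsLocalRing.residue A ((⟨g, hd⟩ : A.decompositionSubgroup F) • (⟨x, hx⟩ : A)) =
        IsLocalRing.residue A ⟨x, hx⟩
    rw [← sub_eq_zero, ← map_sub, IsLocalRing.residue_eq_zero_iff]
    exact ValuationSubring.coe_mem_nonunits_iff.1 (h x hx)

/-! ### The image of the homomorphism to the wreath product -/

section Group

variable {Γ : Type v} {G : Type u} [Group Γ] [Group G] {N : Subgroup Γ} {hN : N.index = 2}
  {r : N →* G} {y : Γ} {hyN : y ∉ N} {hy : orderOf y = 2}

open scoped Classical in
lemma wreathHom_apply_twist : wreathHom N hN r y hyN hy y = sigma G := by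
  have hyy : y * y = 1 := by rw [← sq, ← hy]; exact pow_orderOf_eq_one y
  have h : r ⟨y * y, (Subgroup.mul_mem_iff_of_index_two hN).2 Iff.rfl⟩ = 1 := by
    rw [← map_one r]; congr 1; ext; exact hyy
  change (if hx : y ∈ N then _ else _) = _
  rw [dif_neg hyN, h, pair]
  have : (![1, 1] : Fin 2 → G) = 1 := by ext i; fin_cases i <;> rfl
  rw [this, map_one, one_mul]

open scoped Classical in
lemma wreathHom_right_of_mem {x : Γ} (hx : x ∈ N) : (wreathHom N hN r y hyN hy x).right = 1 := by
  change (if hx : x ∈ N then _ else _ : Wreath G).right = _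
  rw [dif_pos hx]; rfl

open scoped Classical in
lemma wreathHom_left_of_mem {x : Γ} (hx : x ∈ N) :
    (wreathHom N hN r y hyN hy x).left 0 = r ⟨x, hx⟩ := by
  change (if hx : x ∈ N then _ else _ : Wreath G).left 0 = _
  rw [dif_pos hx]; rfl

open scoped Classical in
lemma wreathHom_right_of_notMem {x : Γ} (hx : x ∉ N) :
    (wreathHom N hN r y hyN hy x).right ≠ 1 := by
  change (if hx : x ∈ N then _ else _ : Wreath G).right ≠ 1
  rw [dif_neg hx, SemidirectProduct.mul_right]
  simp only [pair, sigma, SemidirectProduct.right_inl, SemidirectProduct.right_inr, one_mul]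
  decide

/-- If `Γ` is generated by its involutions outside of `N` and `r` is surjective, then the image of
`wreathHom` is admissible. -/
lemma isAdmissible_range_wreathHom (hr : Function.Surjective r)
    (hgen : Subgroup.closure {x : Γ | x ∉ N ∧ orderOf x = 2} = ⊤) :
    IsAdmissible (wreathHom N hN r y hyN hy).range where
  sigma_mem := ⟨y, wreathHom_apply_twist⟩
  ker_surj g := by
    obtain ⟨x, rfl⟩ := hr g
    exact ⟨_, ⟨x.1, rfl⟩, wreathHom_right_of_mem x.2, wreathHom_left_of_mem x.2⟩
  generated := by
    refine le_antisymm ((Subgroup.closure_le _).2 fun x hx => hx.1) ?_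
    have himg : (wreathHom N hN r y hyN hy).range =
        Subgroup.closure (wreathHom N hN r y hyN hy '' {x : Γ | x ∉ N ∧ orderOf x = 2}) := by
      rw [MonoidHom.range_eq_map, ← hgen, MonoidHom.map_closure]
    refine himg.trans_le (Subgroup.closure_mono <| Set.image_subset_iff.2 ?_)
    rintro x ⟨hxN, hx⟩
    have hne := wreathHom_right_of_notMem (hN := hN) (r := r) (hyN := hyN) (hy := hy) hxN
    refine ⟨⟨x, rfl⟩, ?_, hne⟩
    refine orderOf_eq_prime ?_ fun h => hne (by rw [h]; rfl)
    have hx2 : x ^ 2 = 1 := by rw [← hx]; exact pow_orderOf_eq_one x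
    rw [← map_pow, hx2, map_one]

end Group

/-! ### From generation by involutions to admissibility -/

section Setup

variable {Q : Type u} [Field Q] {vinf : Place Q} {K : IntermediateField Q (SeparableClosure Q)}
  {G : Type v} [Group G] [TopologicalSpace G] [DiscreteTopology G]

lemma projHom_surjective (ρ : GalUnram vinf K →ₜ* G) (hρ : Function.Surjective ρ) :
    Function.Surjective (projHom ρ) := by
  intro g
  obtain ⟨s, rfl⟩ := hρ g
  obtain ⟨s, rfl⟩ := AlgEquiv.restrictNormalHom_surjective (SeparableClosure Q) s
  have hx : ∀ z : closureOf ρ,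
      (AlgEquiv.restrictNormalHom (closureOf ρ) (s.restrictScalars Q) z : SeparableClosure Q)
        = s z := fun z => AlgEquiv.restrictNormalHom_apply _ _ _
  refine ⟨⟨AlgEquiv.restrictNormalHom (closureOf ρ) (s.restrictScalars Q), ?_⟩, ?_⟩
  · refine (IntermediateField.mem_fixingSubgroup_iff _ _).2 fun z hz => Subtype.ext ?_
    rw [hx]
    exact s.commutes ⟨z, (IntermediateField.mem_restrict (base_le ρ) z).1 hz⟩
  · exact inflate_congr ρ _ _ fun z hz =>
      ((exists_lift ρ _).choose_spec ⟨z, hz⟩).trans (hx _)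

lemma isAdmissible_of_pairHasType (hK : Module.finrank Q K = 2) (ρ : GalUnram vinf K →ₜ* G)
    (hρ : Function.Surjective ρ)
    (hgen : Subgroup.closure {x : Gal(closureOf ρ/Q) | x ∉ kerSubgroup ρ ∧ orderOf x = 2} = ⊤)
    {y : Gal(closureOf ρ/Q)} {G' : Subgroup (Wreath G)} (h : PairHasType hK ρ y G') :
    IsAdmissible G' := by
  obtain ⟨hy, rfl⟩ := h
  exact isAdmissible_range_wreathHom (projHom_surjective ρ hρ) hgen

end Setup

/-! ### Lifting decomposition and inertia elements through rings of invariants -/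

section Lifting

open scoped Pointwise

variable {B C N : Type*} [CommRing B] [CommRing C] [Algebra B C] [Group N] [Finite N]
  [MulSemiringAction N C] [SMulCommClass N B C] [Algebra.IsInvariant B C N]

-- The primes `P` and `τ P` have the same contraction to `B`, and `N` permutes the primes over a
-- given one transitively.
variable (N) in
lemma exists_smul_comp_mem_iff (P : Ideal C) [P.IsPrime] (τ : C ≃+* C) (τ' : B ≃+* B)
    (hτ : ∀ b, τ (algebraMap B C b) = algebraMap B C (τ' b))
    (h : ∀ b, algebraMap B C (τ' b) ∈ P ↔ algebraMap B C b ∈ P) :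
    ∃ n : N, ∀ c, n • τ c ∈ P ↔ c ∈ P := by
  have hsymm : ∀ b, τ.symm (algebraMap B C b) = algebraMap B C (τ'.symm b) := fun b => by
    rw [RingEquiv.symm_apply_eq, hτ, RingEquiv.apply_symm_apply]
  have hunder : (P.comap (τ.symm : C →+* C)).under B = P.under B := by
    ext b
    rw [Ideal.mem_comap, Ideal.mem_comap, Ideal.mem_comap]
    change τ.symm _ ∈ P ↔ _
    rw [hsymm, ← h, RingEquiv.apply_symm_apply]
  have : (P.comap (τ.symm : C →+* C)).IsPrime := Ideal.comap_isPrime _ _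
  obtain ⟨n, hn⟩ := Algebra.IsInvariant.exists_smul_of_under_eq B C N _ P hunder
  refine ⟨n, fun c => ?_⟩
  conv_lhs => rw [hn]
  rw [Ideal.smul_mem_pointwise_smul_iff, Ideal.mem_comap]
  change τ.symm _ ∈ P ↔ _
  rw [RingEquiv.symm_apply_apply]

variable (N) in
lemma exists_smul_comp_sub_mem (P : Ideal C) [P.IsPrime] (τ : C ≃+* C) (τ' : B ≃+* B)
    (hτ : ∀ b, τ (algebraMap B C b) = algebraMap B C (τ' b))
    (h : ∀ b, algebraMap B C (τ' b) - algebraMap B C b ∈ P) :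
    ∃ n : N, ∀ c, n • τ c - c ∈ P := by
  obtain ⟨n, hn⟩ := exists_smul_comp_mem_iff N P τ τ' hτ fun b =>
    ⟨fun hb => by simpa using P.sub_mem hb (h b), fun hb => by simpa using P.add_mem (h b) hb⟩
  have hmap : P = P.map ((τ.trans (MulSemiringAction.toRingEquiv N C n) : C ≃+* C) : C →+* C) := by
    refine ((Ideal.map_comap_eq_self_of_equiv
      (τ.trans (MulSemiringAction.toRingEquiv N C n)) P).symm.trans (congrArg _ ?_))
    ext c
    exact hn c
  -- The map induced by `n • τ` on `C ⧸ P` is linear over the residue ring of `B`, because `τ'` is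
  -- trivial on `B` modulo `P`. The stabilizer of `P` surjects onto such automorphisms, so some `m`
  -- induces the inverse.
  let f : (C ⧸ P) ≃ₐ[B ⧸ P.under B] (C ⧸ P) :=
    AlgEquiv.ofRingEquiv (f := Ideal.quotientEquiv P P
      (τ.trans (MulSemiringAction.toRingEquiv N C n)) hmap) <| by
      rintro ⟨b⟩
      change Ideal.Quotient.mk P (n • τ (algebraMap B C b)) = Ideal.Quotient.mk P (algebraMap B C b)
      rw [hτ, smul_algebraMap, Ideal.Quotient.eq]
      exact h b
  obtain ⟨m, hm⟩ := Ideal.Quotient.stabilizerHom_surjective N (P.under B) P f.symm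
  refine ⟨m * n, fun c => ?_⟩
  rw [← Ideal.Quotient.eq, mul_smul]
  have h1 := DFunLike.congr_fun hm (f (Ideal.Quotient.mk P c))
  rw [f.symm_apply_apply] at h1
  exact h1

end Lifting

/-! ### Valuation rings as localizations of integral closures -/

section Localization

variable {R F : Type*} [CommRing R] [Field F] [Algebra R F]

/-- A valuation subring of `F` whose valuation ring is the localization of the integral closure of
`R` at `P`. -/
structure IsLocalizationAt (P : Ideal (integralClosure R F)) (A : ValuationSubring F) : Prop where
  mem : ∀ x : integralClosure R F, (x : F) ∈ A
  mem_nonunits : ∀ x : integralClosure R F, (x : F) ∈ A.nonunits ↔ x ∈ P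
  exists_mul_eq : ∀ z ∈ A, ∃ a b : integralClosure R F, b ∉ P ∧ z * b = a
  ne_top : A ≠ ⊤

lemma exists_isLocalizationAt [IsDedekindDomain (integralClosure R F)]
    [IsFractionRing (integralClosure R F) F] (P : Ideal (integralClosure R F)) [hP : P.IsPrime]
    (hbot : P ≠ ⊥) : ∃ A : ValuationSubring F, IsLocalizationAt P A := by
  let v : IsDedekindDomain.HeightOneSpectrum (integralClosure R F) := ⟨P, hP, hbot⟩
  refine ⟨(v.valuation F).valuationSubring, fun x => v.valuation_le_one x, fun x => ?_,
    fun z hz => ?_, ?_⟩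
  · rw [← v.valuation_lt_one_iff_mem (K := F), ValuationSubring.mem_nonunits_iff]
    exact ((v.valuation F).isEquiv_valuation_valuationSubring.lt_one_iff_lt_one).symm
  · obtain ⟨a, b, h⟩ := v.exists_primeCompl_mul_eq_of_integer z hz
    exact ⟨a, b, b.2, h⟩
  · simp only [ne_eq, Valuation.valuationSubring_eq_top_iff, not_not]
    infer_instance

variable {Q : Type*} [Field Q] [Algebra R Q] [Algebra Q F] [IsScalarTower R Q F]

namespace IsLocalizationAt

variable {P : Ideal (integralClosure R F)} {A : ValuationSubring F}

lemma div_mem (h : IsLocalizationAt P A) (a b : integralClosure R F) (hb : b ∉ P) :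
    (a : F) / b ∈ A := by
  have hb' : (b : F)⁻¹ ∈ A := by
    by_contra hb'
    refine hb ((h.mem_nonunits b).1 ?_)
    rw [ValuationSubring.mem_nonunits_iff_or]
    exact .inr hb'
  rw [div_eq_mul_inv]
  exact A.mul_mem _ _ (h.mem a) hb'

lemma div_mem_nonunits (h : IsLocalizationAt P A) (a b : integralClosure R F) (ha : a ∈ P)
    (hb : b ∉ P) : (a : F) / b ∈ A.nonunits := by
  have hb' : (b : F)⁻¹ ∈ A := by simpa using h.div_mem 1 b hb
  rw [ValuationSubring.mem_nonunits_iff, div_eq_mul_inv, map_mul]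
  exact mul_lt_one_of_lt_of_le ((h.mem_nonunits a).2 ha) ((A.valuation_le_one_iff _).2 hb')

lemma exists_eq_div (h : IsLocalizationAt P A) {z : F} (hz : z ∈ A) :
    ∃ a b : integralClosure R F, b ∉ P ∧ z = a / b := by
  obtain ⟨a, b, hb, hz⟩ := h.exists_mul_eq z hz
  refine ⟨a, b, hb, ?_⟩
  rw [eq_div_iff, hz]
  rintro h0
  exact hb (by rw [(ZeroMemClass.coe_eq_zero).1 h0]; exact P.zero_mem)

lemma mem_inertiaGroup (h : IsLocalizationAt P A) (hP : P.IsPrime) (σ : Gal(F/Q))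
    (hσ : ∀ x : integralClosure R F, σ • x - x ∈ P) :
    σ ∈ (Place.nonarch A h.ne_top).inertiaGroup Q := by
  rw [Place.mem_inertiaGroup_nonarch]
  intro z hz
  obtain ⟨a, b, hb, rfl⟩ := h.exists_eq_div hz
  have hσb : σ • b ∉ P := fun hσb => hb (by simpa using P.sub_mem hσb (hσ b))
  have hb0 : (b : F) ≠ 0 := fun h0 => hb (by rw [(ZeroMemClass.coe_eq_zero).1 h0]; exact P.zero_mem)
  have hσb0 : σ (b : F) ≠ 0 := by simpa using hb0
  have key : σ ((a : F) / b) - a / b =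
      ((σ • a * b - a * σ • b : integralClosure R F) : F) / (σ • b * b : integralClosure R F) := by
    rw [map_div₀]
    change _ = (σ (a : F) * b - a * σ (b : F)) / (σ (b : F) * b)
    field_simp
  rw [key]
  refine h.div_mem_nonunits _ _ ?_ (fun h' => (hP.mem_or_mem h').elim hσb hb)
  have : σ • a * b - a * σ • b = (σ • a - a) * b - a * (σ • b - b) := by ring
  rw [this]
  exact P.sub_mem (P.mul_mem_right _ (hσ a)) (P.mul_mem_left _ (hσ b))

lemma mem_decompositionGroup (h : IsLocalizationAt P A) (σ : Gal(F/Q))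
    (hσ : ∀ x : integralClosure R F, σ • x ∈ P ↔ x ∈ P) :
    σ ∈ (Place.nonarch A h.ne_top).decompositionGroup Q := by
  have key : ∀ τ : Gal(F/Q), (∀ x : integralClosure R F, τ • x ∈ P ↔ x ∈ P) →
      ∀ z ∈ A, τ z ∈ A := fun τ hτ z hz => by
    obtain ⟨a, b, hb, rfl⟩ := h.exists_eq_div hz
    rw [map_div₀]
    exact h.div_mem (τ • a) (τ • b) (by rwa [hτ])
  rw [Place.mem_decompositionGroup_nonarch]
  refine fun z => ⟨fun hz => ?_, key σ hσ z⟩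
  have := key σ⁻¹ (fun x => by rw [← hσ, smul_inv_smul]) _ hz
  rwa [← AlgEquiv.mul_apply, inv_mul_cancel] at this

end IsLocalizationAt

end Localization

/-! ### Lifting from a Galois subextension -/

section Descent

variable (R : Type*) {Q M F : Type*} [CommRing R] [Field Q] [Field M] [Field F]
  [Algebra Q M] [Algebra Q F] [Algebra M F] [Algebra R M] [Algebra R F] [IsScalarTower R M F]

variable (M F) in
/-- The inclusion of the integral closures of `R` in `M ⊆ F`. -/
abbrev integralClosureMap : integralClosure R M →+* integralClosure R F :=
  ((IsScalarTower.toAlgHom R M F).mapIntegralClosure : _ →+* _)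

instance smulCommClass_gal : SMulCommClass Gal(F/M) R F :=
  ⟨fun σ r x => map_smul ((σ : F →ₐ[M] F).restrictScalars R) r x⟩

lemma isInvariant_integralClosure [FiniteDimensional M F] [IsGalois M F] :
    letI := (integralClosureMap R M F).toAlgebra
    Algebra.IsInvariant (integralClosure R M) (integralClosure R F) Gal(F/M) := by
  let := (integralClosureMap R M F).toAlgebra
  refine ⟨fun x hx => ?_⟩
  have h1 : (x : F) ∈ (⊥ : IntermediateField M F) := by
    rw [IsGalois.mem_bot_iff_fixed]
    exact fun σ => congrArg Subtype.val (hx σ)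
  obtain ⟨z, hz⟩ := IntermediateField.mem_bot.1 h1
  refine ⟨⟨z, ?_⟩, Subtype.ext hz⟩
  have h2 : IsIntegral R (algebraMap M F z) := by rw [hz]; exact x.2
  exact (isIntegral_algebraMap_iff (algebraMap M F).injective).1 h2

instance smulCommClass_integralClosure :
    letI := (integralClosureMap R M F).toAlgebra
    SMulCommClass Gal(F/M) (integralClosure R M) (integralClosure R F) := by
  let := (integralClosureMap R M F).toAlgebra
  refine ⟨fun σ b c => Subtype.ext ?_⟩
  have h : ∀ c : integralClosure R F, ((b • c : integralClosure R F) : F) = (b : M) • (c : F) :=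
    fun c => by rw [Algebra.smul_def, Algebra.smul_def]; rfl
  change σ ((b • c : integralClosure R F) : F) = ((b • (σ • c) : integralClosure R F) : F)
  rw [h, h, map_smul]
  rfl

lemma restrictNormalHom_restrictScalars_mul [IsScalarTower Q M F] [IsGalois Q M]
    (σ' : Gal(F/Q)) (n : Gal(F/M)) :
    AlgEquiv.restrictNormalHom M (n.restrictScalars Q * σ') = AlgEquiv.restrictNormalHom M σ' := by
  rw [map_mul]
  convert one_mul _
  ext z
  refine (algebraMap M F).injective ?_
  exact (AlgEquiv.restrictNormal_commutes (n.restrictScalars Q) M z).trans (n.commutes z)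

variable [IsScalarTower Q M F] [FiniteDimensional Q F] [IsGalois Q F] [IsGalois Q M]
  [Algebra R Q] [IsScalarTower R Q M] [IsScalarTower R Q F]

variable {R} (P : Ideal (integralClosure R F)) [P.IsPrime]

/-- An arbitrary lift to `F` is corrected by an element of `Gal(F/M)`, which leaves the restriction
to `M` unchanged. -/
lemma exists_lift_smul_mem_iff (σ : Gal(M/Q))
    (hσ : ∀ x : integralClosure R M,
      integralClosureMap R M F (σ • x) ∈ P ↔ integralClosureMap R M F x ∈ P) :
    ∃ τ : Gal(F/Q), AlgEquiv.restrictNormalHom M τ = σ ∧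
      ∀ x : integralClosure R F, τ • x ∈ P ↔ x ∈ P := by
  let := (integralClosureMap R M F).toAlgebra
  have : FiniteDimensional M F := .right Q M F
  have : IsGalois M F := .tower_top_of_isGalois Q M F
  have := isInvariant_integralClosure R (M := M) (F := F)
  obtain ⟨σ', rfl⟩ := AlgEquiv.restrictNormalHom_surjective F σ
  obtain ⟨n, hn⟩ := exists_smul_comp_mem_iff Gal(F/M) P
    (MulSemiringAction.toRingEquiv _ (integralClosure R F) σ')
    (MulSemiringAction.toRingEquiv _ (integralClosure R M) (AlgEquiv.restrictNormalHom M σ'))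
    (fun b => Subtype.ext (AlgEquiv.restrictNormal_commutes σ' M b).symm) hσ
  exact ⟨n.restrictScalars Q * σ', restrictNormalHom_restrictScalars_mul σ' n, fun x => hn x⟩

lemma exists_lift_smul_sub_mem (σ : Gal(M/Q))
    (hσ : ∀ x : integralClosure R M, integralClosureMap R M F (σ • x - x) ∈ P) :
    ∃ τ : Gal(F/Q), AlgEquiv.restrictNormalHom M τ = σ ∧
      ∀ x : integralClosure R F, τ • x - x ∈ P := by
  let := (integralClosureMap R M F).toAlgebra
  have : FiniteDimensional M F := .right Q M F
  have : IsGalois M F := .tower_top_of_isGalois Q M F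
  have := isInvariant_integralClosure R (M := M) (F := F)
  obtain ⟨σ', rfl⟩ := AlgEquiv.restrictNormalHom_surjective F σ
  obtain ⟨n, hn⟩ := exists_smul_comp_sub_mem Gal(F/M) P
    (MulSemiringAction.toRingEquiv _ (integralClosure R F) σ')
    (MulSemiringAction.toRingEquiv _ (integralClosure R M) (AlgEquiv.restrictNormalHom M σ'))
    (fun b => Subtype.ext (AlgEquiv.restrictNormal_commutes σ' M b).symm)
    (fun b => by rw [← map_sub]; exact hσ b)
  exact ⟨n.restrictScalars Q * σ', restrictNormalHom_restrictScalars_mul σ' n, fun x => hn x⟩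

end Descent

/-! ### Fixed fields of subgroups containing all inertia; the case of ℚ -/

section InertiaTrivial

variable (R : Type*) {M F : Type*} [CommRing R] [IsDedekindDomain R] [Field M] [Field F]
  [Algebra M F] [Algebra R M] [Algebra R F] [IsScalarTower R M F]

variable (F) in
lemma exists_isLocalizationAt_over (Q : Type*) [Field Q] [Algebra Q F] [FiniteDimensional Q F]
    [Algebra.IsSeparable Q F] [Algebra R Q] [IsScalarTower R Q F] [IsFractionRing R Q]
    (p : Ideal (integralClosure R M)) [p.IsPrime] (hp : p ≠ ⊥) :
    ∃ (P : Ideal (integralClosure R F)) (A : ValuationSubring F),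
      P.IsPrime ∧ IsLocalizationAt P A ∧ ∀ x, integralClosureMap R M F x ∈ P ↔ x ∈ p := by
  let := (integralClosureMap R M F).toAlgebra
  have hsc : IsScalarTower R (integralClosure R M) (integralClosure R F) :=
    .of_algebraMap_eq fun x => Subtype.ext (IsScalarTower.algebraMap_apply R M F x)
  have : Algebra.IsIntegral (integralClosure R M) (integralClosure R F) := .tower_top (R := R)
  have hinj : Function.Injective (algebraMap (integralClosure R M) (integralClosure R F)) :=
    fun x y h => Subtype.ext ((algebraMap M F).injective (congrArg Subtype.val h))
  obtain ⟨P, hPmem, hPp, hPc⟩ := Ideal.exists_ideal_over_prime_of_isIntegral p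
    (⊥ : Ideal (integralClosure R F)) (by
      intro x hx
      have : x = 0 := hinj ((Ideal.mem_bot.1 (Ideal.mem_comap.1 hx)).trans (map_zero _).symm)
      rw [this]; exact p.zero_mem)
  have hbot : P ≠ ⊥ := by
    rintro rfl
    refine hp (hPc.symm.trans ?_)
    exact Ideal.comap_bot_of_injective _ hinj
  have := integralClosure.isDedekindDomain R Q F
  have := integralClosure.isFractionRing_of_finite_extension (A := R) Q F
  obtain ⟨A, hA⟩ := exists_isLocalizationAt P hbot
  exact ⟨P, A, hPp, hA, fun x => by rw [← hPc]; rfl⟩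

variable {Q : Type*} [Field Q] [Algebra Q M] [Algebra Q F] [IsScalarTower Q M F]
  [FiniteDimensional Q F] [IsGalois Q F] [IsGalois Q M] [Algebra R Q] [IsScalarTower R Q M]
  [IsScalarTower R Q F] [IsFractionRing R Q]

/-- An inertia element at `p` lifts to an inertia element of a place of `F` above `p`; the lift lies
in `S`, which acts trivially on `M`. -/
lemma eq_one_of_smul_sub_mem {S : Subgroup Gal(F/Q)}
    (hM : ∀ τ ∈ S, AlgEquiv.restrictNormalHom M τ = 1)
    (hS : ∀ (A : ValuationSubring F) (hA : A ≠ ⊤), (Place.nonarch A hA).inertiaGroup Q ≤ S)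
    (p : Ideal (integralClosure R M)) [p.IsPrime] (hp : p ≠ ⊥)
    (σ : Gal(M/Q)) (hσ : ∀ x : integralClosure R M, σ • x - x ∈ p) : σ = 1 := by
  obtain ⟨P, A, hP, hA, hPp⟩ := exists_isLocalizationAt_over R F Q p hp
  obtain ⟨τ, rfl, hτ⟩ := exists_lift_smul_sub_mem P σ fun x => (hPp _).2 (hσ x)
  exact hM τ (hS A hA.ne_top (hA.mem_inertiaGroup hP τ hτ))

end InertiaTrivial

/-- There is no proper extension of `ℚ` that is unramified at all finite places. -/
lemma finrank_eq_one_of_inertia {M : Type*} [Field M] [NumberField M] [IsGalois ℚ M]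
    (h : ∀ (p : Ideal (integralClosure ℤ M)) [p.IsPrime], p ≠ ⊥ → ∀ σ : Gal(M/ℚ),
      (∀ x : integralClosure ℤ M, σ • x - x ∈ p) → σ = 1) : Module.finrank ℚ M = 1 := by
  by_contra H
  obtain ⟨P, hP, hram⟩ := NumberField.exists_not_isUnramifiedAt_int (𝒪 := integralClosure ℤ M) H
  have := integralClosure.isFractionRing_of_finite_extension (A := ℤ) ℚ M
  have := IsIntegralClosure.finite ℤ ℚ M (integralClosure ℤ M)
  have := IsGaloisGroup.of_isFractionRing Gal(M/ℚ) ℤ (integralClosure ℤ M) ℚ M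
  have := integralClosure.isDedekindDomain ℤ ℚ M
  have hbot : P ≠ ⊥ := Ideal.IsMaximal.ne_bot_of_isIntegral_int P
  refine hram ?_
  have hI : P.inertia Gal(M/ℚ) = ⊥ :=
    (Subgroup.eq_bot_iff_forall _).2 fun σ hσ => h P hbot σ hσ
  -- In a Galois extension the ramification index is the order of the inertia group.
  rw [← Ideal.ramificationIdx_eq_one_iff,
    ← Ideal.ramificationIdxIn_eq_ramificationIdx (P.under ℤ) _ Gal(M/ℚ),
    ← Ideal.card_inertia_eq_ramificationIdxIn (G := Gal(M/ℚ)) _ P]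
  exact (congrArg (fun H : Subgroup Gal(M/ℚ) => Nat.card H) hI).trans (by simp)

lemma restrictNormalHom_fixedField_eq_one {Q F : Type*} [Field Q] [Field F] [Algebra Q F]
    [FiniteDimensional Q F] [IsGalois Q F] (S : Subgroup Gal(F/Q)) [S.Normal] {τ : Gal(F/Q)}
    (hτ : τ ∈ S) : AlgEquiv.restrictNormalHom (IntermediateField.fixedField S) τ = 1 := by
  refine AlgEquiv.ext fun z => Subtype.ext ?_
  rw [AlgEquiv.restrictNormalHom_apply]
  exact z.2 ⟨τ, hτ⟩

lemma eq_top_of_finrank_fixedField_eq_one {Q F : Type*} [Field Q] [Field F] [Algebra Q F]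
    [FiniteDimensional Q F] [IsGalois Q F] (S : Subgroup Gal(F/Q))
    (h : Module.finrank Q (IntermediateField.fixedField S) = 1) : S = ⊤ := by
  rw [IntermediateField.finrank_eq_one_iff] at h
  rw [← IntermediateField.fixingSubgroup_fixedField S, h, IntermediateField.fixingSubgroup_bot]

lemma eq_top_of_inertiaGroup_le (R : Type*) {Q : Type*} {F : Type u} [CommRing R]
    [IsDedekindDomain R] [Field Q] [Field F] [Algebra R Q] [IsFractionRing R Q] [Algebra Q F]
    [FiniteDimensional Q F] [IsGalois Q F] (S : Subgroup Gal(F/Q)) [S.Normal]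
    (hS : ∀ (A : ValuationSubring F) (hA : A ≠ ⊤), (Place.nonarch A hA).inertiaGroup Q ≤ S)
    (hR : ∀ (M : Type u) [Field M] [Algebra Q M] [Algebra R M] [IsScalarTower R Q M]
      [FiniteDimensional Q M] [IsGalois Q M],
      (∀ (p : Ideal (integralClosure R M)) [p.IsPrime], p ≠ ⊥ → ∀ σ : Gal(M/Q),
        (∀ x : integralClosure R M, σ • x - x ∈ p) → σ = 1) → Module.finrank Q M = 1) :
    S = ⊤ := by
  let := ((algebraMap Q F).comp (algebraMap R Q)).toAlgebra
  have : IsScalarTower R Q F := .of_algebraMap_eq' rfl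
  refine eq_top_of_finrank_fixedField_eq_one S (hR (IntermediateField.fixedField S) ?_)
  intro p _ hp σ hσ
  have : IsScalarTower R (IntermediateField.fixedField S) F := .of_algebraMap_eq' rfl
  exact eq_one_of_smul_sub_mem R (M := IntermediateField.fixedField S)
    (fun τ hτ => restrictNormalHom_fixedField_eq_one S hτ) hS p hp σ hσ

lemma eq_top_of_inertiaGroup_le_rat {F : Type*} [Field F] [Algebra ℚ F] [FiniteDimensional ℚ F]
    [IsGalois ℚ F] (S : Subgroup Gal(F/ℚ)) [S.Normal]
    (hS : ∀ (A : ValuationSubring F) (hA : A ≠ ⊤), (Place.nonarch A hA).inertiaGroup ℚ ≤ S) :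
    S = ⊤ := by
  refine eq_top_of_inertiaGroup_le ℤ S hS fun M _ alg alg' _ _ _ h => ?_
  have : CharZero M := algebraRat.charZero M
  -- Algebra structures over ℚ and ℤ are unique, so the given ones may be replaced by the canonical
  -- ones.
  obtain rfl : alg = DivisionRing.toRatAlgebra := Subsingleton.elim _ _
  obtain rfl : alg' = Ring.toIntAlgebra M := Subsingleton.elim _ _
  have : NumberField M := { }
  exact finrank_eq_one_of_inertia h

/-! ### The determinant of conjugates -/

section UnitDet

variable {R Q M : Type*} [CommRing R] [Field Q] [Field M] [Algebra R Q] [Algebra Q M]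
  [Algebra R M] [IsScalarTower R Q M]

variable (Q) in
/-- The matrix of conjugates of a family of integral elements. -/
abbrev conjMatrix (e : Gal(M/Q) → integralClosure R M) :
    Matrix Gal(M/Q) Gal(M/Q) (integralClosure R M) :=
  Matrix.of fun σ τ => σ • e τ

/-- Applying `σ` permutes the rows, which changes the determinant by a sign. -/
lemma smul_det_conjMatrix_sq [Fintype Gal(M/Q)] [DecidableEq Gal(M/Q)]
    (e : Gal(M/Q) → integralClosure R M) (σ : Gal(M/Q)) :
    σ • (conjMatrix Q e).det ^ 2 = (conjMatrix Q e).det ^ 2 := by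
  have h : σ • (conjMatrix Q e).det = ((conjMatrix Q e).submatrix (Equiv.mulLeft σ) id).det := by
    have := (MulSemiringAction.toRingHom Gal(M/Q) (integralClosure R M) σ).map_det (conjMatrix Q e)
    refine this.trans (congrArg _ ?_)
    ext i j : 1
    exact (mul_smul σ i (e j)).symm
  rw [smul_pow', h, Matrix.det_permute, mul_pow]
  have h2 : ((Equiv.Perm.sign (Equiv.mulLeft σ) : ℤ) : integralClosure R M) ^ 2 = 1 := by
    rw [← Int.cast_pow, ← Units.val_pow_eq_pow_val, Int.units_sq]
    simp
  rw [h2, one_mul]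

variable [IsFractionRing R Q] [FiniteDimensional Q M] [IsGalois Q M]

lemma exists_algebraMap_eq_of_smul_eq [IsIntegrallyClosed R] [IsDomain R]
    (x : integralClosure R M) (hx : ∀ σ : Gal(M/Q), σ • x = x) :
    ∃ r : R, algebraMap R (integralClosure R M) r = x := by
  have h1 : (x : M) ∈ (⊥ : IntermediateField Q M) := by
    rw [IsGalois.mem_bot_iff_fixed]
    exact fun σ => congrArg Subtype.val (hx σ)
  obtain ⟨z, hz⟩ := IntermediateField.mem_bot.1 h1
  have h2 : IsIntegral R (algebraMap Q M z) := by rw [hz]; exact x.2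
  obtain ⟨r, rfl⟩ := IsIntegrallyClosed.isIntegral_iff.1
    ((isIntegral_algebraMap_iff (algebraMap Q M).injective).1 h2)
  exact ⟨r, Subtype.ext ((IsScalarTower.algebraMap_apply R Q M r).trans hz)⟩

/-- If all inertia groups of `M/Q` are trivial, the matrix of conjugates of an integral basis is
invertible. -/
lemma exists_isUnit_det_conjMatrix [Fintype Gal(M/Q)] [DecidableEq Gal(M/Q)] [IsDomain R]
    [IsPrincipalIdealRing R] (hR : ¬ IsField R)
    (h : ∀ (p : Ideal (integralClosure R M)) [p.IsPrime], p ≠ ⊥ → ∀ σ : Gal(M/Q),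
      (∀ x : integralClosure R M, σ • x - x ∈ p) → σ = 1) :
    ∃ e : Gal(M/Q) → integralClosure R M, IsUnit (conjMatrix Q e).det := by
  have htf : Module.IsTorsionFree R M := .trans_faithfulSMul R Q M
  have hinj : Function.Injective (algebraMap R (integralClosure R M)) :=
    FaithfulSMul.algebraMap_injective _ _
  have := IsIntegralClosure.module_free R Q M (integralClosure R M)
  have hrank := IsIntegralClosure.rank R Q M (integralClosure R M)
  have := IsIntegralClosure.finite R Q M (integralClosure R M)
  have hcard : Fintype.card Gal(M/Q) = Module.finrank R (integralClosure R M) := by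
    rw [hrank, ← IsGalois.card_aut_eq_finrank, Nat.card_eq_fintype_card]
  let b : Module.Basis Gal(M/Q) R (integralClosure R M) :=
    (Module.finBasis R (integralClosure R M)).reindex (Fintype.equivFinOfCardEq hcard).symm
  refine ⟨b, ?_⟩
  by_contra hu
  obtain ⟨p, hp, hmem⟩ := exists_max_ideal_of_mem_nonunits hu
  have hnf : ¬ IsField (integralClosure R M) := fun hf =>
    hR ((Algebra.IsIntegral.isField_iff_isField hinj).2 hf)
  have hbot : p ≠ ⊥ := Ring.ne_bot_of_isMaximal_of_not_isField hp hnf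
  let := Ideal.Quotient.field p
  let f : Gal(M/Q) → (integralClosure R M →* integralClosure R M ⧸ p) := fun σ =>
    ((Ideal.Quotient.mk p).comp (MulSemiringAction.toRingHom _ _ σ) : _ →+* _)
  -- Two automorphisms with equal reductions modulo `p` differ by an inertia element. The reductions
  -- are therefore distinct characters, linearly independent by Dedekind, while a singular matrix
  -- modulo `p` gives a relation between them on the basis `b`.
  have hf : Function.Injective f := by
    intro σ τ hστ
    have := h p hbot (σ * τ⁻¹) fun x => by
      rw [← Ideal.Quotient.eq, mul_smul]
      refine (DFunLike.congr_fun hστ (τ⁻¹ • x)).trans ?_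
      exact congrArg (Ideal.Quotient.mk p) (smul_inv_smul τ x)
    rwa [mul_inv_eq_one] at this
  have hli :=
    (linearIndependent_monoidHom (integralClosure R M) (integralClosure R M ⧸ p)).comp f hf
  rw [← Ideal.Quotient.eq_zero_iff_mem, RingHom.map_det] at hmem
  obtain ⟨c, hc0, hc⟩ := Matrix.exists_vecMul_eq_zero_iff.2 hmem
  refine hc0 (funext (Fintype.linearIndependent_iff.1 hli c ?_))
  funext x
  rw [← b.sum_repr x]
  have hc' : ∀ τ, ∑ σ, c σ * Ideal.Quotient.mk p (σ • b τ) = 0 := fun τ => congrFun hc τ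
  simp only [Function.comp_apply, Finset.sum_apply, Pi.smul_apply, smul_eq_mul, Pi.zero_apply]
  have key : ∀ σ, f σ (∑ τ, b.repr x τ • b τ) =
      ∑ τ, algebraMap R (integralClosure R M ⧸ p) (b.repr x τ) * Ideal.Quotient.mk p (σ • b τ) :=
    fun σ => by
      change Ideal.Quotient.mk p (σ • ∑ τ, b.repr x τ • b τ) = _
      rw [Finset.smul_sum, map_sum]
      refine Finset.sum_congr rfl fun τ _ => ?_
      rw [smul_comm, Algebra.smul_def, map_mul]
      rfl
  simp only [key, Finset.mul_sum]
  rw [Finset.sum_comm]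
  refine Finset.sum_eq_zero fun τ _ => ?_
  rw [← mul_zero (algebraMap R (integralClosure R M ⧸ p) (b.repr x τ)), ← hc' τ, Finset.mul_sum]
  exact Finset.sum_congr rfl fun σ _ => mul_left_comm _ _ _

end UnitDet

/-! ### Extensions of k(t) unramified at finite places and split at infinity -/

section RatFunc

open Polynomial

lemma nonunits_mul_mem {M : Type*} [Field M] {B : ValuationSubring M} {x y : M} (hx : x ∈ B)
    (hy : y ∈ B.nonunits) : x * y ∈ B.nonunits := by
  rw [ValuationSubring.mem_nonunits_iff, mul_comm, map_mul]
  exact mul_lt_one_of_lt_of_le hy ((B.valuation_le_one_iff _).2 hx)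

variable {k M : Type*} [Field k] [Field M] [Algebra (RatFunc k) M]

open scoped Classical in
/-- The valuation ring `B` lies over the place at infinity of `k(t)`, has uniformizer `t⁻¹` and
residue field `k`; moreover all sets of conjugates have bounded denominators. -/
structure IsSplitAtInfty (B : ValuationSubring M) : Prop where
  comap_eq : B.comap (algebraMap (RatFunc k) M) = (RatFunc.inftyValuation k).valuationSubring
  X_mul_mem : ∀ x ∈ B.nonunits, algebraMap (RatFunc k) M RatFunc.X * x ∈ B
  exists_sub_mem : ∀ x ∈ B, ∃ c : k, x - algebraMap (RatFunc k) M (RatFunc.C c) ∈ B.nonunits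
  bounded : ∀ x : M, ∃ d : ℕ, ∀ σ : Gal(M/RatFunc k),
    σ x / algebraMap (RatFunc k) M RatFunc.X ^ d ∈ B

namespace IsSplitAtInfty

variable {B : ValuationSubring M}

open scoped Classical in
lemma algebraMap_mem_iff (hB : IsSplitAtInfty (k := k) B) (q : RatFunc k) :
    algebraMap (RatFunc k) M q ∈ B ↔ RatFunc.inftyValuation k q ≤ 1 := by
  rw [← ValuationSubring.mem_comap, hB.comap_eq]
  rfl

lemma C_mem (hB : IsSplitAtInfty (k := k) B) (c : k) :
    algebraMap (RatFunc k) M (RatFunc.C c) ∈ B := by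
  classical
  rw [hB.algebraMap_mem_iff]
  by_cases hc : c = 0
  · simp [hc]
  · rw [RatFunc.inftyValuation.C _ hc]

lemma inv_X_mem_nonunits (hB : IsSplitAtInfty (k := k) B) :
    (algebraMap (RatFunc k) M RatFunc.X)⁻¹ ∈ B.nonunits := by
  classical
  rw [B.inv_mem_nonunits_iff, hB.algebraMap_mem_iff, RatFunc.inftyValuation.X]
  exact .inr (by rw [← WithZero.exp_zero, WithZero.exp_le_exp]; norm_num)

lemma polynomial_notMem_nonunits (hB : IsSplitAtInfty (k := k) B) {p : k[X]} (hp : p ≠ 0) :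
    algebraMap (RatFunc k) M (algebraMap k[X] (RatFunc k) p) ∉ B.nonunits := by
  classical
  rw [ValuationSubring.mem_nonunits_iff_or, not_or, not_not]
  refine ⟨by simpa using hp, ?_⟩
  rw [← map_inv₀, hB.algebraMap_mem_iff, map_inv₀, RatFunc.inftyValuation_apply,
    RatFunc.inftyValuation.polynomial k hp]
  rw [inv_le_one₀ (by simp), ← WithZero.exp_zero, WithZero.exp_le_exp]
  exact Int.natCast_nonneg _

variable [Algebra k[X] M] [IsScalarTower k[X] (RatFunc k) M]

/-- The pole order of `x` at infinity: the least `d` such that `x / t ^ d` is integral at all places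
over infinity. -/
noncomputable def poleOrder (B : ValuationSubring M) (x : integralClosure k[X] M) : ℕ :=
  sInf {d : ℕ | ∀ σ : Gal(M/RatFunc k),
    ((σ • x : integralClosure k[X] M) : M) / algebraMap (RatFunc k) M RatFunc.X ^ d ∈ B}

/-- By `bounded` the set of exponents is non-empty, so its infimum is attained and is not the
default value `0`. -/
lemma div_pow_poleOrder_mem (hB : IsSplitAtInfty (k := k) B) (x : integralClosure k[X] M)
    (σ : Gal(M/RatFunc k)) : ((σ • x : integralClosure k[X] M) : M) /
      algebraMap (RatFunc k) M RatFunc.X ^ poleOrder B x ∈ B :=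
  Nat.sInf_mem (s := {d : ℕ | ∀ σ : Gal(M/RatFunc k), ((σ • x : integralClosure k[X] M) : M) /
    algebraMap (RatFunc k) M RatFunc.X ^ d ∈ B}) (hB.bounded x) σ

variable [FiniteDimensional (RatFunc k) M] [IsGalois (RatFunc k) M]

/-- The norm of `y` is a polynomial vanishing at infinity, hence zero. -/
lemma eq_zero_of_mem_nonunits (hB : IsSplitAtInfty (k := k) B)
    (y : integralClosure k[X] M)
    (hy : ∀ σ : Gal(M/RatFunc k), ((σ • y : integralClosure k[X] M) : M) ∈ B)
    (hy1 : (y : M) ∈ B.nonunits) : y = 0 := by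
  classical
  obtain ⟨a, ha⟩ := exists_algebraMap_eq_of_smul_eq (Q := RatFunc k)
    (∏ σ : Gal(M/RatFunc k), σ • y) (fun σ => Finset.smul_prod_perm y σ)
  by_contra hy0
  have hne : ∏ σ : Gal(M/RatFunc k), σ • y ≠ 0 :=
    Finset.prod_ne_zero_iff.2 fun σ _ => by rwa [Ne, smul_eq_zero_iff_eq]
  have ha0 : a ≠ 0 := by
    rintro rfl
    exact hne (by rw [← ha, map_zero])
  refine hB.polynomial_notMem_nonunits ha0 ?_
  rw [← IsScalarTower.algebraMap_apply]
  have : algebraMap k[X] M a = (algebraMap k[X] (integralClosure k[X] M) a : M) := rfl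
  rw [this, ha, ← Finset.prod_erase_mul _ _ (Finset.mem_univ 1), one_smul]
  change ((∏ σ ∈ Finset.univ.erase (1 : Gal(M/RatFunc k)), σ • y : integralClosure k[X] M) : M) * y
    ∈ _
  refine nonunits_mul_mem ?_ hy1
  rw [← Subalgebra.coe_val, map_prod]
  exact B.toSubring.prod_mem fun σ _ => hy σ

/-- A relation modulo the place at infinity between the leading coefficients of the `e τ` leads to a
family whose determinant is again invertible and whose total pole order is smaller. -/
lemma exists_smaller [DecidableEq Gal(M/RatFunc k)]
    (hB : IsSplitAtInfty (k := k) B) (e : Gal(M/RatFunc k) → integralClosure k[X] M)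
    (he : IsUnit (conjMatrix (RatFunc k) e).det) (c : Gal(M/RatFunc k) → k) (hc : c ≠ 0)
    (hrel : ∀ σ : Gal(M/RatFunc k), ∑ τ, algebraMap (RatFunc k) M (RatFunc.C (c τ)) *
      (((σ • e τ : integralClosure k[X] M) : M) /
        algebraMap (RatFunc k) M RatFunc.X ^ poleOrder B (e τ)) ∈ B.nonunits) :
    ∃ e' : Gal(M/RatFunc k) → integralClosure k[X] M, IsUnit (conjMatrix (RatFunc k) e').det ∧
      ∑ τ, poleOrder B (e' τ) < ∑ τ, poleOrder B (e τ) := by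
  classical
  set T := algebraMap (RatFunc k) M RatFunc.X with hT
  have hT0 : T ≠ 0 := by simpa [hT] using RatFunc.X_ne_zero
  have hne : (Finset.univ.filter fun τ => c τ ≠ 0).Nonempty := by
    obtain ⟨τ, hτ⟩ := Function.ne_iff.1 hc
    exact ⟨τ, by simpa using hτ⟩
  -- Only `e j`, of largest pole order among the terms of the relation, is replaced: multiplying the
  -- other terms by powers of `t` lifts the relation to the integral element `y`, and the
  -- determinant changes only by the constant `c j`.
  obtain ⟨j, hj, hjmax⟩ := Finset.exists_max_image _ (fun τ => poleOrder B (e τ)) hne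
  have hcj : c j ≠ 0 := by simpa using hj
  set r : Gal(M/RatFunc k) → integralClosure k[X] M := fun τ =>
    algebraMap k[X] _ (C (c τ) * X ^ (poleOrder B (e j) - poleOrder B (e τ))) with hr
  set y : integralClosure k[X] M := ∑ τ, r τ * e τ with hy
  have hsmulr : ∀ (σ : Gal(M/RatFunc k)) τ, σ • r τ = r τ := fun σ τ => smul_algebraMap _ _
  have hdet : (conjMatrix (RatFunc k) (Function.update e j y)).det =
      r j • (conjMatrix (RatFunc k) e).det := by
    rw [← Matrix.det_updateCol_sum]
    congr 1
    ext σ τ : 2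
    by_cases h : τ = j
    · subst h
      simp [conjMatrix, hy, Finset.smul_sum, smul_mul', hsmulr]
    · simp [conjMatrix, h]
  have hrj : IsUnit (r j) := by
    rw [hr]
    simp only [tsub_self, pow_zero, mul_one]
    exact (Polynomial.isUnit_C.2 (isUnit_iff_ne_zero.2 hcj)).map _
  have hunit : IsUnit (conjMatrix (RatFunc k) (Function.update e j y)).det := by
    rw [hdet, smul_eq_mul]
    exact hrj.mul he
  have hrM : ∀ τ, ((r τ : integralClosure k[X] M) : M) =
      algebraMap (RatFunc k) M (RatFunc.C (c τ)) *
        T ^ (poleOrder B (e j) - poleOrder B (e τ)) := fun τ => by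
    change algebraMap k[X] M _ = _
    rw [IsScalarTower.algebraMap_apply k[X] (RatFunc k) M]
    simp [hT]
  have hσy : ∀ σ : Gal(M/RatFunc k), ((σ • y : integralClosure k[X] M) : M) =
      T ^ poleOrder B (e j) * ∑ τ, algebraMap (RatFunc k) M (RatFunc.C (c τ)) *
      (((σ • e τ : integralClosure k[X] M) : M) / T ^ poleOrder B (e τ)) := fun σ => by
    rw [hy, Finset.smul_sum, ← Subalgebra.coe_val, map_sum, Finset.mul_sum]
    refine Finset.sum_congr rfl fun τ _ => ?_
    rw [smul_mul', hsmulr, map_mul]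
    simp only [Subalgebra.coe_val, hrM]
    -- The subtraction of exponents may truncate when `c τ = 0`, but then the term vanishes.
    by_cases h0 : c τ = 0
    · simp [h0]
    · have hle : poleOrder B (e τ) ≤ poleOrder B (e j) := hjmax τ (by simpa using h0)
      rw [pow_sub₀ _ hT0 hle]
      field_simp
  refine ⟨Function.update e j y, hunit, ?_⟩
  -- If the pole order were zero, `y` would be integral everywhere and vanish at infinity, so `y =
  -- 0`, giving a zero column.
  have hpos : poleOrder B (e j) ≠ 0 := by
    intro h0
    have hmem : ∀ σ : Gal(M/RatFunc k), ((σ • y : integralClosure k[X] M) : M) ∈ B.nonunits :=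
      fun σ => by
        rw [hσy, h0, pow_zero, one_mul]
        exact hrel σ
    have hy0 : y = 0 := hB.eq_zero_of_mem_nonunits y (fun σ => B.nonunits_subset (hmem σ))
      (by simpa using hmem 1)
    rw [Matrix.det_eq_zero_of_column_eq_zero j (fun σ => by simp [conjMatrix, hy0])] at hunit
    exact not_isUnit_zero hunit
  -- All conjugates of `y / t ^ d`, with `d` the pole order of `e j`, lie in the maximal ideal;
  -- since `t⁻¹` is a uniformizer, one factor `t` can be absorbed.
  have hlt : poleOrder B y < poleOrder B (e j) := by
    refine lt_of_le_of_lt (Nat.sInf_le (m := poleOrder B (e j) - 1) fun σ => ?_)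
      (Nat.sub_one_lt hpos)
    have := hB.X_mul_mem _ (hrel σ)
    obtain ⟨d, hd⟩ := Nat.exists_eq_succ_of_ne_zero hpos
    have hcancel : ∀ s : M, T ^ (d + 1) * s / T ^ d = T * s := fun s => by
      rw [pow_succ]
      field_simp
    rw [hσy, hd, Nat.succ_sub_one, ← hT, Nat.succ_eq_add_one, hcancel]
    exact this
  refine Finset.sum_lt_sum (fun τ _ => ?_) ⟨j, Finset.mem_univ j, by simpa using hlt⟩
  by_cases h : τ = j
  · subst h
    simpa using hlt.le
  · simp [h]

/-- An extension of `k(t)` that is unramified at all finite places and split at infinity is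
trivial. -/
theorem finrank_eq_one (hB : IsSplitAtInfty (k := k) B)
    (h : ∀ (p : Ideal (integralClosure k[X] M)) [p.IsPrime], p ≠ ⊥ → ∀ σ : Gal(M/RatFunc k),
      (∀ x : integralClosure k[X] M, σ • x - x ∈ p) → σ = 1) :
    Module.finrank (RatFunc k) M = 1 := by
  classical
  have hinh := exists_isUnit_det_conjMatrix (Polynomial.not_isField k) h
  obtain ⟨e, he, hmin⟩ := (InvImage.wf
    (fun e : Gal(M/RatFunc k) → integralClosure k[X] M => ∑ τ, poleOrder B (e τ))
    Nat.lt_wfRel.wf).has_min {e | IsUnit (conjMatrix (RatFunc k) e).det} hinh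
  set T := algebraMap (RatFunc k) M RatFunc.X with hT
  have hT0 : T ≠ 0 := by simpa [hT] using RatFunc.X_ne_zero
  let N : Matrix Gal(M/RatFunc k) Gal(M/RatFunc k) B :=
    Matrix.of fun σ τ => ⟨_, hB.div_pow_poleOrder_mem (e τ) σ⟩
  -- A kernel vector over the residue field has entries represented by constants in `k`, so
  -- `exists_smaller` would contradict minimality.
  have hN : IsUnit N.det := by
    by_contra hN
    rw [← IsLocalRing.residue_ne_zero_iff_isUnit, not_not, RingHom.map_det] at hN
    obtain ⟨c, hc0, hc⟩ := Matrix.exists_mulVec_eq_zero_iff.2 hN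
    have hlift : ∀ τ, ∃ c' : k, IsLocalRing.residue B
        ⟨algebraMap (RatFunc k) M (RatFunc.C c'), hB.C_mem c'⟩ = c τ := fun τ => by
      obtain ⟨z, hz⟩ := IsLocalRing.residue_surjective (c τ)
      obtain ⟨c', hc'⟩ := hB.exists_sub_mem z z.2
      refine ⟨c', ?_⟩
      rw [← hz, eq_comm, ← sub_eq_zero, ← map_sub, IsLocalRing.residue_eq_zero_iff]
      exact ValuationSubring.coe_mem_nonunits_iff.1 hc'
    choose c' hc' using hlift
    have hc'0 : c' ≠ 0 := by
      rintro rfl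
      refine hc0 (funext fun τ => (hc' τ).symm.trans ((IsLocalRing.residue_eq_zero_iff _).2
        (ValuationSubring.coe_mem_nonunits_iff.1 ?_)))
      simp
    obtain ⟨e', he', hlt⟩ := hB.exists_smaller e he c' hc'0 fun σ => by
      have h1 := congrFun hc σ
      have h2 : IsLocalRing.residue B (∑ τ, ⟨_, hB.C_mem (c' τ)⟩ * N σ τ) = 0 := by
        refine (map_sum _ _ _).trans (Eq.trans (Finset.sum_congr rfl fun τ _ => ?_) h1)
        rw [map_mul, hc', mul_comm]
        rfl
      rw [IsLocalRing.residue_eq_zero_iff, ← ValuationSubring.coe_mem_nonunits_iff] at h2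
      rw [← B.subtype_apply, map_sum] at h2
      exact h2
    exact hmin e' he' hlt
  have hdet : ((N.det : B) : M) =
      (∏ τ, (T ^ poleOrder B (e τ))⁻¹) * (conjMatrix (RatFunc k) e).det := by
    rw [← B.subtype_apply, RingHom.map_det, ← Subalgebra.coe_val]
    rw [AlgHom.map_det, ← Matrix.det_mul_row]
    congr 1
    ext σ τ
    exact div_eq_inv_mul _ _
  -- The squared determinant is Galois invariant, hence a polynomial; being a unit, it is a
  -- constant.
  obtain ⟨a, ha⟩ := exists_algebraMap_eq_of_smul_eq (R := k[X]) (Q := RatFunc k)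
    ((conjMatrix (RatFunc k) e).det ^ 2) (smul_det_conjMatrix_sq e)
  have hau : IsUnit a := by
    have : Module.IsTorsionFree k[X] M := .trans_faithfulSMul k[X] (RatFunc k) M
    exact isUnit_of_map_unit (algebraMap k[X] (integralClosure k[X] M)) a
      (by rw [ha]; exact IsUnit.pow 2 he)
  obtain ⟨c, hc, rfl⟩ := Polynomial.isUnit_iff.1 hau
  have hsq : ((N.det : B) : M) ^ 2 = algebraMap (RatFunc k) M (RatFunc.C c) *
      (T⁻¹ ^ ∑ τ, poleOrder B (e τ)) ^ 2 := by
    have : (((conjMatrix (RatFunc k) e).det : integralClosure k[X] M) : M) ^ 2 =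
        algebraMap (RatFunc k) M (RatFunc.C c) := by
      refine (congrArg Subtype.val ha).symm.trans ?_
      change algebraMap k[X] M _ = _
      rw [IsScalarTower.algebraMap_apply k[X] (RatFunc k) M]
      simp
    rw [hdet, mul_pow, this, mul_comm, ← Finset.prod_pow_eq_pow_sum]
    simp only [inv_pow]
  -- Otherwise the square of `N.det`, a constant times a positive power of `t⁻¹`, would lie in the
  -- maximal ideal.
  have hzero : ∑ τ, poleOrder B (e τ) = 0 := by
    by_contra hne
    obtain ⟨d, hd⟩ := Nat.exists_eq_succ_of_ne_zero hne
    have hu : IsUnit (N.det ^ 2) := hN.pow 2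
    refine (IsLocalRing.mem_maximalIdeal _).1 ?_ hu
    rw [← ValuationSubring.coe_mem_nonunits_iff]
    change ((N.det : B) : M) ^ 2 ∈ _
    have hTn := hB.inv_X_mem_nonunits
    have hTm := B.nonunits_subset hTn
    have hpow : (T⁻¹ ^ d.succ) ^ 2 = T⁻¹ ^ (2 * d + 1) * T⁻¹ := by
      rw [← pow_mul, ← pow_succ]
      congr 1
      omega
    rw [hsq, hd, hpow, ← mul_assoc]
    exact nonunits_mul_mem (B.mul_mem _ _ (hB.C_mem c) (B.toSubring.pow_mem hTm _)) hTn
  have hmem : ∀ (σ τ : Gal(M/RatFunc k)), ((σ • e τ : integralClosure k[X] M) : M) ∈ B :=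
    fun σ τ => by
      have h1 := hB.div_pow_poleOrder_mem (e τ) σ
      rwa [(Finset.sum_eq_zero_iff.1 hzero) τ (Finset.mem_univ τ), pow_zero, div_one] at h1
  -- Each `e τ` is integral everywhere; subtracting its residue in `k` gives an element that
  -- vanishes at infinity, hence zero.
  have hconst : ∀ τ, ∃ c : k, e τ = algebraMap k[X] _ (C c) := fun τ => by
    obtain ⟨c, hc⟩ := hB.exists_sub_mem (e τ) (by simpa using hmem 1 τ)
    have hCM : ((algebraMap k[X] (integralClosure k[X] M) (C c) : integralClosure k[X] M) : M) =
        algebraMap (RatFunc k) M (RatFunc.C c) := by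
      change algebraMap k[X] M _ = _
      rw [IsScalarTower.algebraMap_apply k[X] (RatFunc k) M]
      simp
    refine ⟨c, sub_eq_zero.1 (hB.eq_zero_of_mem_nonunits _ (fun σ => ?_) ?_)⟩
    · rw [smul_sub, smul_algebraMap]
      change ((σ • e τ : integralClosure k[X] M) : M) - _ ∈ B
      rw [hCM]
      exact B.toSubring.sub_mem (hmem σ τ) (hB.C_mem c)
    · change ((e τ : integralClosure k[X] M) : M) - _ ∈ _
      rw [hCM]
      exact hc
  have hsub : Subsingleton Gal(M/RatFunc k) := by
    refine ⟨fun σ τ => ?_⟩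
    by_contra hne
    have he0 : IsUnit (conjMatrix (RatFunc k) e).det := he
    rw [Matrix.det_zero_of_row_eq hne] at he0
    · exact not_isUnit_zero he0
    · ext ρ : 1
      obtain ⟨c, hc⟩ := hconst ρ
      change σ • e ρ = τ • e ρ
      rw [hc, smul_algebraMap, smul_algebraMap]
  rw [← IsGalois.card_aut_eq_finrank]
  exact Nat.card_unique

end IsSplitAtInfty

end RatFunc

/-! ### Places with trivial decomposition group -/

section SplitPlace

/-- By integrality `P` contracts to the maximal ideal of `V`, and an element outside `V` has its
inverse in that ideal. -/
lemma IsLocalizationAt.comap_algebraMap_eq {Q F : Type*} [Field Q] [Field F] [Algebra Q F]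
    {V : ValuationSubring Q} [Algebra V F] [IsScalarTower V Q F] {P : Ideal (integralClosure V F)}
    {A : ValuationSubring F} (hA : IsLocalizationAt P A) (hP : P.IsMaximal) :
    A.comap (algebraMap Q F) = V := by
  have hmax : (P.comap (algebraMap V (integralClosure V F))).IsMaximal :=
    Ideal.isMaximal_comap_of_isIntegral_of_isMaximal P
  have hV : ∀ v : V, algebraMap Q F v = (algebraMap V (integralClosure V F) v : F) :=
    fun v => (IsScalarTower.algebraMap_apply V Q F v).symm
  ext q
  rw [ValuationSubring.mem_comap]
  refine ⟨fun hq => ?_, fun hq => ?_⟩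
  · by_contra hq'
    have h1 : q⁻¹ ∈ V := (V.mem_or_inv_mem q).resolve_left hq'
    have h2 : (⟨q⁻¹, h1⟩ : V) ∈ IsLocalRing.maximalIdeal V := by
      rw [← ValuationSubring.coe_mem_nonunits_iff]
      exact V.inv_mem_nonunits_iff.2 (.inr hq')
    rw [← IsLocalRing.eq_maximalIdeal hmax, Ideal.mem_comap, ← hA.mem_nonunits, ← hV, map_inv₀,
      A.inv_mem_nonunits_iff] at h2
    rcases h2 with h2 | h2
    · exact hq' (by rw [(map_eq_zero _).1 h2]; exact V.zero_mem)
    · exact h2 hq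
  · have := hA.mem (algebraMap V (integralClosure V F) ⟨q, hq⟩)
    rwa [← hV] at this

lemma algebraMap_mem_iff_mem_maximalIdeal {Q M : Type*} [Field Q] [Field M]
    {V : ValuationSubring Q} [Algebra V M] {p : Ideal (integralClosure V M)} (hp : p.IsMaximal)
    (v : V) :
    algebraMap V (integralClosure V M) v ∈ p ↔ v ∈ IsLocalRing.maximalIdeal V := by
  have hmax : (p.comap (algebraMap V (integralClosure V M))).IsMaximal :=
    Ideal.isMaximal_comap_of_isIntegral_of_isMaximal p
  rw [← IsLocalRing.eq_maximalIdeal hmax, Ideal.mem_comap]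

variable {R Q M : Type*} [CommRing R] [Field Q] [Field M] [Algebra R Q] [Algebra Q M]
  [Algebra R M] [IsScalarTower R Q M] {p : Ideal (integralClosure R M)}

/-- If no nontrivial automorphism fixes the maximal ideal `p`, there is an integral element that is
`1` modulo `p` and `0` modulo all conjugates of `p`. -/
lemma exists_sub_one_mem [Finite Gal(M/Q)] (hp : p.IsMaximal)
    (h : ∀ σ : Gal(M/Q), (∀ x : integralClosure R M, σ • x ∈ p ↔ x ∈ p) → σ = 1) :
    ∃ w : integralClosure R M, w - 1 ∈ p ∧ ∀ σ : Gal(M/Q), σ ≠ 1 → σ • w ∈ p := by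
  classical
  cases nonempty_fintype Gal(M/Q)
  -- For `σ ≠ 1` the maximal ideals `p` and `σ⁻¹ p` differ, so some element of `σ⁻¹ p` is `1` modulo
  -- `p`. The product over all `σ` serves every `σ` at once.
  have hb : ∀ σ : Gal(M/Q), ∃ b : integralClosure R M, b - 1 ∈ p ∧ (σ ≠ 1 → σ • b ∈ p) := by
    intro σ
    by_cases hσ : σ = 1
    · exact ⟨1, by simp, fun h => absurd hσ h⟩
    let f := MulSemiringAction.toRingEquiv _ (integralClosure R M) σ
    have hmax : (p.comap f).IsMaximal := Ideal.comap_isMaximal_of_equiv f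
    have hle : ¬ p.comap f ≤ p := fun hle => hσ (h σ fun x => by
      have := hmax.eq_of_le hp.ne_top hle
      conv_rhs => rw [← this]
      rfl)
    obtain ⟨x, hx, hxp⟩ := SetLike.not_le_iff_exists.1 hle
    obtain ⟨y, i, hi, hy⟩ := hp.exists_inv hxp
    refine ⟨y * x, ?_, fun _ => ?_⟩
    · rw [← hy]
      simpa using hi
    · rw [smul_mul']
      exact p.mul_mem_left _ hx
  choose b hb1 hb2 using hb
  refine ⟨∏ σ, b σ, ?_, fun σ hσ => ?_⟩
  · rw [← Ideal.Quotient.eq, map_prod, map_one]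
    exact Finset.prod_eq_one fun σ _ => Ideal.Quotient.eq.2 (hb1 σ)
  · rw [← Finset.mul_prod_erase _ _ (Finset.mem_univ σ), smul_mul']
    exact p.mul_mem_right _ (hb2 σ hσ)

variable {V : ValuationSubring Q} [Algebra V M] [IsScalarTower V Q M] [FiniteDimensional Q M]
  [IsGalois Q M] {p : Ideal (integralClosure V M)} {B : ValuationSubring M}

lemma IsLocalizationAt.exists_sub_mem_nonunits (hB : IsLocalizationAt p B) (hp : p.IsMaximal)
    (h : ∀ σ : Gal(M/Q), (∀ x : integralClosure V M, σ • x ∈ p ↔ x ∈ p) → σ = 1)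
    {z : M} (hz : z ∈ B) : ∃ q ∈ V, z - algebraMap Q M q ∈ B.nonunits := by
  classical
  obtain ⟨w, hw1, hw⟩ := exists_sub_one_mem hp h
  -- The trace of `x * w` lies in `V`, and modulo `p` only the term of the identity, congruent to
  -- `x`, survives.
  have key : ∀ x : integralClosure V M, ∃ v : V, x - algebraMap V _ v ∈ p := by
    intro x
    obtain ⟨v, hv⟩ := exists_algebraMap_eq_of_smul_eq (Q := Q)
      (∑ σ : Gal(M/Q), σ • (x * w)) (fun σ => by
        rw [Finset.smul_sum]
        simp_rw [← mul_smul]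
        exact Fintype.sum_equiv (Equiv.mulLeft σ) _ _ fun _ => rfl)
    refine ⟨v, ?_⟩
    rw [hv, ← Finset.add_sum_erase _ _ (Finset.mem_univ 1), one_smul]
    have : x - (x * w + ∑ σ ∈ Finset.univ.erase (1 : Gal(M/Q)), σ • (x * w)) =
        -(x * (w - 1)) - ∑ σ ∈ Finset.univ.erase (1 : Gal(M/Q)), σ • (x * w) := by ring
    rw [this]
    refine p.sub_mem (p.neg_mem (p.mul_mem_left _ hw1)) (p.sum_mem fun σ hσ => ?_)
    rw [smul_mul']
    exact p.mul_mem_left _ (hw σ (Finset.ne_of_mem_erase hσ))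
  obtain ⟨a, b, hb, rfl⟩ := hB.exists_eq_div hz
  obtain ⟨c, hc⟩ := key a
  obtain ⟨d, hd⟩ := key b
  have hdp : algebraMap V (integralClosure V M) d ∉ p := fun hdp => hb (by
    simpa using p.add_mem hd hdp)
  have hdu : IsUnit d := by
    by_contra hdu
    exact hdp ((algebraMap_mem_iff_mem_maximalIdeal hp d).2 hdu)
  obtain ⟨d', hd'⟩ := hdu.exists_right_inv
  refine ⟨(c * d' : V), (c * d' : V).2, ?_⟩
  have hbd : b * algebraMap V _ d ∉ p := fun hbd => (hp.isPrime.mem_or_mem hbd).elim hb hdp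
  have key2 : (a : M) / b - algebraMap Q M ((c * d' : V) : Q) =
      ((a * algebraMap V _ d - b * algebraMap V _ c : integralClosure V M) : M) /
        (b * algebraMap V _ d : integralClosure V M) := by
    have hV : ∀ v : V, algebraMap Q M v = algebraMap V M v :=
      fun v => (IsScalarTower.algebraMap_apply V Q M v).symm
    have hb0 : (b : M) ≠ 0 := fun h0 => hb (by
      rw [(ZeroMemClass.coe_eq_zero).1 h0]; exact p.zero_mem)
    have hd0 : algebraMap V M d ≠ 0 := fun h0 => hdp (by
      rw [show algebraMap V (integralClosure V M) d = 0 from Subtype.ext h0]; exact p.zero_mem)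
    have hdd : algebraMap V M d * algebraMap V M d' = 1 := by rw [← map_mul, hd', map_one]
    rw [hV, map_mul]
    push_cast
    field_simp
    linear_combination (-(b : M) * algebraMap V M c) * hdd
  rw [key2]
  refine hB.div_mem_nonunits _ _ ?_ hbd
  have : a * algebraMap V _ d - b * algebraMap V (integralClosure V M) c =
      (a - algebraMap V _ c) * algebraMap V _ d - (b - algebraMap V _ d) * algebraMap V _ c := by
    ring
  rw [this]
  exact p.sub_mem (p.mul_mem_right _ hc) (p.mul_mem_right _ hd)

lemma IsLocalizationAt.mul_mem_of_mem_nonunits (hB : IsLocalizationAt p B) (hp : p.IsMaximal)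
    (h : ∀ σ : Gal(M/Q), (∀ x : integralClosure V M, σ • x ∈ p ↔ x ∈ p) → σ = 1)
    {π : Q} (hπ : ∀ v ∈ V.nonunits, π * v ∈ V) {z : M} (hz : z ∈ B.nonunits) :
    algebraMap Q M π * z ∈ B := by
  classical
  obtain ⟨w, hw1, hw⟩ := exists_sub_one_mem hp h
  have hV : ∀ v : V, algebraMap Q M v = (algebraMap V (integralClosure V M) v : M) :=
    fun v => (IsScalarTower.algebraMap_apply V Q M v).symm
  -- If no other conjugate of `y` lies in `p`, then `y` is its norm, a non-unit of `V`, divided by a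
  -- unit at `p`.
  have key : ∀ y ∈ p, (∀ σ : Gal(M/Q), σ ≠ 1 → σ • y ∉ p) → algebraMap Q M π * y ∈ B := by
    intro y hy hσy
    obtain ⟨v, hv⟩ := exists_algebraMap_eq_of_smul_eq (Q := Q)
      (∏ σ : Gal(M/Q), σ • y) (fun σ => Finset.smul_prod_perm y σ)
    rw [← Finset.mul_prod_erase _ _ (Finset.mem_univ 1), one_smul] at hv
    set u := ∏ σ ∈ Finset.univ.erase (1 : Gal(M/Q)), σ • y with hu
    have hup : u ∉ p := by
      rw [hu, hp.isPrime.prod_mem_iff]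
      rintro ⟨σ, hσ, hσp⟩
      exact hσy σ (Finset.ne_of_mem_erase hσ) hσp
    have hvp : algebraMap V (integralClosure V M) v ∈ p := by
      rw [hv]; exact p.mul_mem_right _ hy
    rw [algebraMap_mem_iff_mem_maximalIdeal hp, ← ValuationSubring.coe_mem_nonunits_iff] at hvp
    have hu0 : (u : M) ≠ 0 := fun h0 => hup (by
      rw [(ZeroMemClass.coe_eq_zero).1 h0]; exact p.zero_mem)
    have := hB.div_mem (algebraMap V _ ⟨π * v, hπ v hvp⟩) u hup
    rw [← hV, map_mul, hV, hv] at this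
    convert this using 1
    push_cast
    field_simp
  have hpmem : ∀ x ∈ p, algebraMap Q M π * x ∈ B := by
    intro x hx
    have hw1' : 1 - w ∈ p := by rw [← neg_sub]; exact p.neg_mem hw1
    -- The conjugates of `y * w + (1 - w)` under `σ ≠ 1` are `1` modulo `p`. Taking `y = x` and `y =
    -- 0` and subtracting handles `x * w`, where `w` is a unit at `p`.
    have hnot : ∀ σ : Gal(M/Q), σ ≠ 1 → ∀ y : integralClosure V M, σ • (y * w + (1 - w)) ∉ p :=
      fun σ hσ y hmem => by
        rw [smul_add, smul_sub, smul_mul', smul_one] at hmem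
        have h2 := p.sub_mem hmem (p.sub_mem (p.mul_mem_left (σ • y) (hw σ hσ)) (hw σ hσ))
        refine hp.ne_top ((Ideal.eq_top_iff_one p).2 ?_)
        convert h2 using 1
        ring
    have h1 := key (x * w + (1 - w)) (p.add_mem (p.mul_mem_right _ hx) hw1')
      (fun σ hσ => hnot σ hσ x)
    have h2 := key (0 * w + (1 - w)) (by simpa using hw1') (fun σ hσ => hnot σ hσ 0)
    have h3 : algebraMap Q M π * ((x : M) * w) ∈ B := by
      have h12 : algebraMap Q M π * ((x : M) * w) =
          algebraMap Q M π * (x * w + (1 - w) : integralClosure V M) -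
            algebraMap Q M π * (0 * w + (1 - w) : integralClosure V M) := by
        push_cast
        ring
      rw [h12]
      exact B.toSubring.sub_mem h1 h2
    have hwp : w ∉ p := fun hwp => hp.ne_top ((Ideal.eq_top_iff_one p).2 (by
      simpa using p.add_mem hwp hw1'))
    have hw0 : (w : M) ≠ 0 := fun h0 => hwp (by
      rw [(ZeroMemClass.coe_eq_zero).1 h0]; exact p.zero_mem)
    have h4 := B.mul_mem _ _ h3 (by simpa using hB.div_mem 1 w hwp)
    convert h4 using 1
    field_simp
  obtain ⟨a, b, hb, rfl⟩ := hB.exists_eq_div (B.nonunits_subset hz)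
  have hb0 : (b : M) ≠ 0 := fun h0 => hb (by
    rw [(ZeroMemClass.coe_eq_zero).1 h0]; exact p.zero_mem)
  have hap : a ∈ p := by
    rw [← hB.mem_nonunits]
    have := nonunits_mul_mem (hB.mem b) hz
    rwa [mul_div_cancel₀ _ hb0] at this
  rw [← mul_div_assoc, div_eq_mul_inv]
  exact B.mul_mem _ _ (hpmem a hap) (by simpa using hB.div_mem 1 b hb)

end SplitPlace

/-! ### The valuation ring at infinity of k(t) -/

section InftyRing

open Polynomial

variable (k : Type*) [Field k]

open scoped Classical in
/-- The valuation ring of the place at infinity of `k(t)`. -/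
noncomputable abbrev inftyRing : ValuationSubring (RatFunc k) :=
  (RatFunc.inftyValuation k).valuationSubring

variable {k}

open scoped Classical in
lemma mem_nonunits_inftyRing {q : RatFunc k} :
    q ∈ (inftyRing k).nonunits ↔ RatFunc.inftyValuation k q < 1 :=
  ((RatFunc.inftyValuation k).isEquiv_valuation_valuationSubring.lt_one_iff_lt_one).symm

lemma X_mul_mem_inftyRing {q : RatFunc k} (hq : q ∈ (inftyRing k).nonunits) :
    RatFunc.X * q ∈ inftyRing k := by
  classical
  rw [mem_nonunits_inftyRing] at hq
  rw [Valuation.mem_valuationSubring_iff]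
  by_cases h : q = 0
  · simp [h]
  rw [RatFunc.inftyValuation_apply, RatFunc.inftyValuation_of_nonzero _ h, ← WithZero.exp_zero,
    WithZero.exp_lt_exp] at hq
  rw [RatFunc.inftyValuation_apply,
    RatFunc.inftyValuation_of_nonzero _ (mul_ne_zero RatFunc.X_ne_zero h),
    RatFunc.intDegree_mul RatFunc.X_ne_zero h, RatFunc.intDegree_X, ← WithZero.exp_zero,
    WithZero.exp_le_exp]
  omega

lemma div_X_pow_mem_inftyRing (q : RatFunc k) :
    q / RatFunc.X ^ q.intDegree.natAbs ∈ inftyRing k := by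
  classical
  rw [Valuation.mem_valuationSubring_iff]
  by_cases h : q = 0
  · simp [h]
  rw [map_div₀, map_pow, RatFunc.inftyValuation.X, RatFunc.inftyValuation_apply,
    RatFunc.inftyValuation_of_nonzero _ h, ← WithZero.exp_nsmul, ← WithZero.exp_sub,
    ← WithZero.exp_zero, WithZero.exp_le_exp]
  rw [nsmul_one]
  have := Int.le_natAbs (a := q.intDegree)
  omega

lemma exists_sub_C_mem_nonunits {q : RatFunc k} (hq : q ∈ inftyRing k) :
    ∃ c : k, q - RatFunc.C c ∈ (inftyRing k).nonunits := by
  classical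
  rw [Valuation.mem_valuationSubring_iff] at hq
  simp_rw [mem_nonunits_inftyRing]
  by_cases h : q = 0
  · exact ⟨0, by simp [h]⟩
  rw [RatFunc.inftyValuation_apply, RatFunc.inftyValuation_of_nonzero _ h, ← WithZero.exp_zero,
    WithZero.exp_le_exp] at hq
  rcases hq.lt_or_eq with hlt | heq
  · refine ⟨0, ?_⟩
    rw [map_zero, sub_zero, RatFunc.inftyValuation_apply, RatFunc.inftyValuation_of_nonzero _ h,
      ← WithZero.exp_zero, WithZero.exp_lt_exp]
    exact hlt
  have hnum := RatFunc.num_ne_zero h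
  have hden := q.denom_ne_zero
  have hdeg : q.num.natDegree = q.denom.natDegree := by
    unfold RatFunc.intDegree at heq
    omega
  -- In degree zero the residue at infinity is the quotient of the leading coefficients.
  set c := q.num.leadingCoeff / q.denom.leadingCoeff with hc
  have hc0 : c ≠ 0 := div_ne_zero (leadingCoeff_ne_zero.2 hnum) (leadingCoeff_ne_zero.2 hden)
  refine ⟨c, ?_⟩
  have hrw : q - RatFunc.C c = algebraMap k[X] (RatFunc k) (q.num - C c * q.denom) /
      algebraMap k[X] (RatFunc k) q.denom := by
    have hd : algebraMap k[X] (RatFunc k) q.denom ≠ 0 := by simpa using hden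
    rw [eq_div_iff hd, sub_mul]
    nth_rewrite 1 [← RatFunc.num_div_denom q]
    rw [div_mul_cancel₀ _ hd, map_sub, map_mul, RatFunc.algebraMap_C]
  by_cases h0 : q.num - C c * q.denom = 0
  · rw [hrw, h0]; simp
  have hlt : (q.num - C c * q.denom).degree < q.num.degree := by
    refine degree_sub_lt_left ?_ hnum ?_
    · rw [degree_C_mul hc0, degree_eq_natDegree hnum, degree_eq_natDegree hden, hdeg]
    · rw [leadingCoeff_mul, leadingCoeff_C, hc, div_mul_cancel₀ _ (leadingCoeff_ne_zero.2 hden)]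
  have hlt' := natDegree_lt_natDegree h0 hlt
  rw [hrw, map_div₀, RatFunc.inftyValuation_apply,
    RatFunc.inftyValuation_apply, RatFunc.inftyValuation.polynomial _ h0,
    RatFunc.inftyValuation.polynomial _ hden,
    ← WithZero.exp_sub, ← WithZero.exp_zero, WithZero.exp_lt_exp]
  omega

instance : IsDiscreteValuationRing (inftyRing k) :=
  Valuation.valuationSubring_isDiscreteValuationRing _

/-- Every element becomes integral at infinity after division by a power of `t`. -/
lemma exists_div_X_pow_isIntegral {M : Type*} [Field M] [Algebra (RatFunc k) M]
    [FiniteDimensional (RatFunc k) M] [Algebra (inftyRing k) M]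
    [IsScalarTower (inftyRing k) (RatFunc k) M] (x : M) :
    ∃ d : ℕ, IsIntegral (inftyRing k) (x / algebraMap (RatFunc k) M RatFunc.X ^ d) := by
  have := (IsFractionRing.comap_isAlgebraic_iff (A := inftyRing k) (K := RatFunc k)
    (C := M)).2 inferInstance
  obtain ⟨y, hy, h⟩ :=
    (Algebra.IsAlgebraic.isAlgebraic (R := inftyRing k) x).exists_integral_multiple
  have hy0 : (y : RatFunc k) ≠ 0 := by simpa using hy
  -- With `y * x` integral, the exponent is chosen so that `y⁻¹ / t ^ d` is itself integral at
  -- infinity.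
  refine ⟨(y : RatFunc k)⁻¹.intDegree.natAbs, ?_⟩
  have hz := h.smul (⟨_, div_X_pow_mem_inftyRing (y : RatFunc k)⁻¹⟩ : inftyRing k)
  refine (congrArg (IsIntegral (inftyRing k)) ?_).mpr hz
  rw [Algebra.smul_def, Algebra.smul_def,
    IsScalarTower.algebraMap_apply (inftyRing k) (RatFunc k) M,
    IsScalarTower.algebraMap_apply (inftyRing k) (RatFunc k) M y]
  have : algebraMap (RatFunc k) M y ≠ 0 := by simpa using hy0
  change _ = algebraMap (RatFunc k) M (_ / _) * (algebraMap (RatFunc k) M y * x)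
  rw [map_div₀, map_inv₀, map_pow]
  field_simp

variable {M : Type*} [Field M] [Algebra (RatFunc k) M] [FiniteDimensional (RatFunc k) M]
  [IsGalois (RatFunc k) M] [Algebra (inftyRing k) M] [IsScalarTower (inftyRing k) (RatFunc k) M]

lemma IsLocalizationAt.isSplitAtInfty {p : Ideal (integralClosure (inftyRing k) M)}
    {B : ValuationSubring M} (hB : IsLocalizationAt p B) (hp : p.IsMaximal)
    (h : ∀ σ : Gal(M/RatFunc k),
      (∀ x : integralClosure (inftyRing k) M, σ • x ∈ p ↔ x ∈ p) → σ = 1) :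
    IsSplitAtInfty (k := k) B where
  comap_eq := hB.comap_algebraMap_eq hp
  X_mul_mem _ hx := hB.mul_mem_of_mem_nonunits hp h (fun _ => X_mul_mem_inftyRing) hx
  exists_sub_mem x hx := by
    obtain ⟨q, hq, hx⟩ := hB.exists_sub_mem_nonunits hp h hx
    obtain ⟨c, hc⟩ := exists_sub_C_mem_nonunits hq
    refine ⟨c, ?_⟩
    have hc' : algebraMap (RatFunc k) M (q - RatFunc.C c) ∈ B.nonunits := by
      rw [B.mem_nonunits_iff_or, ← map_inv₀, ← ValuationSubring.mem_comap,
        hB.comap_algebraMap_eq hp, map_eq_zero, ← (inftyRing k).mem_nonunits_iff_or]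
      exact hc
    have := B.nonunits.add_mem hx hc'
    rwa [map_sub, sub_add_sub_cancel] at this
  bounded x := by
    -- Integrality over the ring at infinity is preserved by `σ`, so one exponent serves all
    -- conjugates.
    obtain ⟨d, hd⟩ := exists_div_X_pow_isIntegral (k := k) x
    refine ⟨d, fun σ => ?_⟩
    have := hd.map (σ.restrictScalars (inftyRing k))
    rw [map_div₀, map_pow] at this
    change IsIntegral _ (σ _ / σ _ ^ _) at this
    rw [σ.commutes] at this
    exact hB.mem ⟨_, this⟩

end InftyRing

/-! ### Local subgroups generate over k(t) -/

section Core

open Polynomial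

lemma eq_top_of_inertiaGroup_le_ratFunc {k : Type u} {F : Type v} [Field k] [Field F]
    [Algebra (RatFunc k) F] [FiniteDimensional (RatFunc k) F] [IsGalois (RatFunc k) F]
    (S : Subgroup Gal(F/RatFunc k)) [S.Normal]
    (hS : ∀ (A : ValuationSubring F) (hA : A ≠ ⊤),
      (Place.nonarch A hA).inertiaGroup (RatFunc k) ≤ S)
    (hS' : ∀ (A : ValuationSubring F) (hA : A ≠ ⊤), (Place.nonarch A hA).LiesOver (ratFuncInfty k) →
      (Place.nonarch A hA).decompositionGroup (RatFunc k) ≤ S) : S = ⊤ := by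
  let M := IntermediateField.fixedField S
  let := ((algebraMap (RatFunc k) F).comp (algebraMap k[X] (RatFunc k))).toAlgebra
  have : IsScalarTower k[X] (RatFunc k) F := .of_algebraMap_eq' rfl
  have : IsScalarTower k[X] M F := .of_algebraMap_eq' rfl
  let := ((algebraMap (RatFunc k) F).comp (algebraMap (inftyRing k) (RatFunc k))).toAlgebra
  have : IsScalarTower (inftyRing k) (RatFunc k) F := .of_algebraMap_eq' rfl
  have : IsScalarTower (inftyRing k) M F := .of_algebraMap_eq' rfl
  have hM : ∀ τ ∈ S, AlgEquiv.restrictNormalHom M τ = 1 :=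
    fun τ hτ => restrictNormalHom_fixedField_eq_one S hτ
  have hinj : Function.Injective (algebraMap (inftyRing k) (integralClosure (inftyRing k) M)) :=
    fun x y h => Subtype.ext ((algebraMap (RatFunc k) M).injective (congrArg Subtype.val h))
  obtain ⟨p, hp, hpV⟩ := Ideal.exists_ideal_over_maximal_of_isIntegral
    (S := integralClosure (inftyRing k) M) (IsLocalRing.maximalIdeal (inftyRing k))
    (by rw [(RingHom.injective_iff_ker_eq_bot _).1 hinj]; exact bot_le)
  have hp0 : p ≠ ⊥ := by
    rintro rfl
    refine IsDiscreteValuationRing.not_a_field (inftyRing k) (hpV.symm.trans ?_)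
    exact Ideal.comap_bot_of_injective _ hinj
  -- An automorphism stabilizing `p` lifts to the decomposition group of a place of `F` over
  -- infinity, which is contained in `S`.
  have hstab : ∀ σ : Gal(M/RatFunc k),
      (∀ x : integralClosure (inftyRing k) M, σ • x ∈ p ↔ x ∈ p) → σ = 1 := fun σ hσ => by
    obtain ⟨P, A, hP, hA, hPp⟩ := exists_isLocalizationAt_over (inftyRing k) F (RatFunc k) p hp0
    obtain ⟨τ, rfl, hτ⟩ := exists_lift_smul_mem_iff P σ fun x => by rw [hPp, hPp, hσ]
    have := integralClosure.isDedekindDomain (inftyRing k) (RatFunc k) F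
    obtain ⟨x, hx, hx0⟩ := Submodule.exists_mem_ne_zero_of_ne_bot hp0
    have hPmax : P.IsMaximal := hP.isMaximal fun h0 => hx0 <| Subtype.ext <|
      (algebraMap M F).injective <| by
        have := (hPp x).2 hx
        rw [h0, Ideal.mem_bot] at this
        exact (congrArg Subtype.val this).trans (map_zero _).symm
    exact hM τ (hS' A hA.ne_top (hA.comap_algebraMap_eq hPmax) (hA.mem_decompositionGroup τ hτ))
  have := integralClosure.isDedekindDomain (inftyRing k) (RatFunc k) M
  have := integralClosure.isFractionRing_of_finite_extension (A := inftyRing k) (RatFunc k) M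
  obtain ⟨B, hB⟩ := exists_isLocalizationAt p hp0
  refine eq_top_of_finrank_fixedField_eq_one S ((hB.isSplitAtInfty hp hstab).finrank_eq_one ?_)
  intro p _ hp σ hσ
  exact eq_one_of_smul_sub_mem k[X] hM hS p hp σ hσ

end Core

/-! ### Conjugation and restriction of local subgroups -/

section Restriction

/-- Otherwise `A` would contain `Q`, and, being integrally closed, all of `F`. -/
lemma ValuationSubring.comap_ne_top {Q E F : Type*} [Field Q] [Field E] [Field F] [Algebra Q E]
    [Algebra Q F] [Algebra.IsIntegral Q F] {A : ValuationSubring F} (hA : A ≠ ⊤) (f : E →ₐ[Q] F) :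
    A.comap (f : E →+* F) ≠ ⊤ := by
  intro h
  refine hA (eq_top_iff.2 fun x _ => ?_)
  have hQ : ∀ q : Q, algebraMap Q F q ∈ A := fun q => by
    have : algebraMap Q E q ∈ A.comap (f : E →+* F) := h ▸ ValuationSubring.mem_top _
    rw [← f.commutes q]
    exact this
  obtain ⟨p, hp, hpx⟩ := Algebra.IsIntegral.isIntegral (R := Q) x
  let g : Q →+* A := (algebraMap Q F).codRestrict A.toSubring hQ
  have hx : IsIntegral A x := ⟨p.map g, hp.map g, by rw [Polynomial.eval₂_map]; exact hpx⟩
  obtain ⟨y, rfl⟩ := IsIntegrallyClosed.algebraMap_eq_of_integral hx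
  exact y.2

lemma ValuationSubring.mem_nonunits_comap {E F : Type*} [Field E] [Field F]
    {A : ValuationSubring F} {f : E →+* F} {x : E} :
    x ∈ (A.comap f).nonunits ↔ f x ∈ A.nonunits := by
  rw [ValuationSubring.mem_nonunits_iff_or, ValuationSubring.mem_nonunits_iff_or,
    ValuationSubring.mem_comap, map_inv₀, map_eq_zero]

variable {Q : Type u} [Field Q]

/-- The subgroups of `Gal(F/Q)` that act trivially on the subextensions of `F` which are unramified
over an intermediate field and split over `vinf`: the inertia groups of the non-archimedean places,
and the decomposition groups of those over `vinf`. -/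
def localSubgroups (vinf : Place Q) (F : Type v) [Field F] [Algebra Q F] :
    Set (Subgroup Gal(F/Q)) :=
  {I | ∃ (A : ValuationSubring F) (hA : A ≠ ⊤), I = (Place.nonarch A hA).inertiaGroup Q ∨
    (Place.nonarch A hA).LiesOver vinf ∧ I = (Place.nonarch A hA).decompositionGroup Q}

lemma exists_conj_mem_localSubgroups {vinf : Place Q} {F : Type v} [Field F] [Algebra Q F]
    [Algebra.IsIntegral Q F] {I : Subgroup Gal(F/Q)} (hI : I ∈ localSubgroups vinf F)
    {σ : Gal(F/Q)} (hσ : σ ∈ I) (τ : Gal(F/Q)) :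
    ∃ J ∈ localSubgroups vinf F, τ⁻¹ * σ * τ ∈ J := by
  obtain ⟨A, hA, rfl | ⟨hv, rfl⟩⟩ := hI
  · refine ⟨_, ⟨_, ValuationSubring.comap_ne_top hA (τ : F →ₐ[Q] F), .inl rfl⟩, ?_⟩
    rw [Place.mem_inertiaGroup_nonarch] at hσ ⊢
    intro x hx
    rw [ValuationSubring.mem_nonunits_comap, map_sub]
    have h : τ ((τ⁻¹ * σ * τ) x) = σ (τ x) := τ.apply_symm_apply _
    change τ _ - τ x ∈ A.nonunits
    rw [h]
    exact hσ (τ x) hx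
  · refine ⟨_, ⟨_, ValuationSubring.comap_ne_top hA (τ : F →ₐ[Q] F), .inr ⟨?_, rfl⟩⟩, ?_⟩
    · cases vinf with
      | arch => exact hv
      | nonarch B hB =>
        refine Eq.trans ?_ hv
        ext q
        exact iff_of_eq (congrArg (· ∈ A) (τ.commutes q))
    · rw [Place.mem_decompositionGroup_nonarch] at hσ ⊢
      intro x
      have h : τ ((τ⁻¹ * σ * τ) x) = σ (τ x) := τ.apply_symm_apply _
      change τ _ ∈ A ↔ τ x ∈ A
      rw [h]
      exact hσ (τ x)

variable {vinf : Place Q} {K : IntermediateField Q (SeparableClosure Q)}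

/-- Restricting the valuation ring from `F` to `E` carries the local condition on `g` to membership
in an inertia or decomposition group of `E/K`, which is trivial. -/
lemma apply_eq_self_of_mem_localSubgroups {E : IntermediateField K (SeparableClosure Q)}
    (hE : E ∈ unramifiedExtensions vinf K) {F : IntermediateField Q (SeparableClosure Q)}
    [IsGalois Q F] (hEF : E.restrictScalars Q ≤ F)
    {I : Subgroup Gal(F/Q)} (hI : I ∈ localSubgroups vinf F)
    (g : Gal(SeparableClosure Q/K))
    (hg : AlgEquiv.restrictNormalHom F (g.restrictScalars Q) ∈ I) {z : SeparableClosure Q}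
    (hz : z ∈ E) : g z = z := by
  obtain ⟨_, _, hunr, hsplit⟩ := hE
  let f : E.restrictScalars Q →ₐ[Q] F := IntermediateField.inclusion hEF
  let f' : E →ₐ[Q] F := f
  have hf : ∀ x : E, f' (AlgEquiv.restrictNormalHom E g x) =
      AlgEquiv.restrictNormalHom F (g.restrictScalars Q) (f' x) := fun x => Subtype.ext <| by
    rw [AlgEquiv.restrictNormalHom_apply]
    exact AlgEquiv.restrictNormalHom_apply E g x
  suffices h : AlgEquiv.restrictNormalHom E g = 1 by
    have := AlgEquiv.restrictNormalHom_apply E g ⟨z, hz⟩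
    rw [h] at this
    exact this.symm
  obtain ⟨A, hA, rfl | ⟨hv, rfl⟩⟩ := hI
  · rw [← Subgroup.mem_bot, ← hunr (.nonarch _ (ValuationSubring.comap_ne_top hA f')),
      Place.mem_inertiaGroup_nonarch]
    rw [Place.mem_inertiaGroup_nonarch] at hg
    intro x hx
    rw [ValuationSubring.mem_nonunits_comap, map_sub]
    exact (hf x).symm ▸ hg _ hx
  · rw [← Subgroup.mem_bot, ← hsplit (.nonarch _ (ValuationSubring.comap_ne_top hA f')) ?_,
      Place.mem_decompositionGroup_nonarch]
    · rw [Place.mem_decompositionGroup_nonarch] at hg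
      intro x
      rw [ValuationSubring.mem_comap, ValuationSubring.mem_comap]
      exact (hf x).symm ▸ hg _
    · cases vinf with
      | arch => exact hv
      | nonarch B hB => exact hv

end Restriction

/-! ### Reduction to a finite Galois extension -/

section FiniteLevel

variable {Q Ω : Type*} [Field Q] [Field Ω] [Algebra Q Ω] [IsGalois Q Ω] {K : IntermediateField Q Ω}
  [FiniteDimensional Q K]

/-- A finite extension `L` of `K` in the compositum of the finite extensions in `Es` is contained in
a finite Galois extension `F` of `Q` such that every `g` which fixes the members of `Es` in `F`
fixes `L`. -/
lemma exists_finite_galois_le {Es : Set (IntermediateField K Ω)}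
    (hEs : ∀ E ∈ Es, FiniteDimensional K E) {L : IntermediateField K Ω} [FiniteDimensional K L]
    (hL : L ≤ ⨆ E : Es, (E : IntermediateField K Ω)) :
    ∃ F : IntermediateField Q Ω, FiniteDimensional Q F ∧ IsGalois Q F ∧
      L.restrictScalars Q ≤ F ∧ ∀ g : Gal(Ω/K),
        (∀ E ∈ Es, E.restrictScalars Q ≤ F → ∀ z ∈ E, g z = z) → ∀ z ∈ L, g z = z := by
  have : Algebra.IsSeparable K L := inferInstance
  -- A primitive element of `L` already lies in the compositum of finitely many members of `Es`.
  obtain ⟨α, hα⟩ := Field.exists_primitive_element K L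
  have hαL : IntermediateField.adjoin K {(α : Ω)} = L := by
    have := congrArg IntermediateField.lift hα
    rwa [IntermediateField.lift_adjoin_simple, IntermediateField.lift_top] at this
  obtain ⟨s, hs⟩ := IntermediateField.exists_finset_of_mem_iSup (hL α.2)
  obtain ⟨N, hN⟩ : ∃ N, N = ⨆ E ∈ s, (E : IntermediateField K Ω) := ⟨_, rfl⟩
  have hLN : L ≤ N := by
    rw [← hαL, IntermediateField.adjoin_simple_le_iff, hN]
    exact hs
  have hEN : ∀ E ∈ s, (E : IntermediateField K Ω) ≤ N := fun E hE =>
    hN ▸ le_iSup₂ (f := fun (E : Es) (_ : E ∈ s) => (E : IntermediateField K Ω)) E hE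
  have : FiniteDimensional K N := hN ▸
    IntermediateField.finiteDimensional_iSup_of_finset' fun E _ => hEs E E.2
  have : FiniteDimensional Q (N.restrictScalars Q) := .trans Q K N
  have hNF := IntermediateField.le_normalClosure (N.restrictScalars Q)
  refine ⟨IntermediateField.normalClosure Q (N.restrictScalars Q) Ω,
    normalClosure.is_finiteDimensional .., { }, le_trans hLN hNF, fun g hg => ?_⟩
  have hgN : N ≤ IntermediateField.fixedField (Subgroup.zpowers g) := by
    rw [hN]
    refine iSup₂_le fun E hE => ?_
    rw [IntermediateField.le_iff_le, Subgroup.zpowers_le, IntermediateField.mem_fixingSubgroup_iff]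
    exact hg E E.2 (le_trans (hEN E hE) hNF)
  rw [IntermediateField.le_iff_le, Subgroup.zpowers_le,
    IntermediateField.mem_fixingSubgroup_iff] at hgN
  exact fun z hz => hgN z (hLN hz)

end FiniteLevel

lemma finiteDimensional_lift {K Ω : Type*} [Field K] [Field Ω] [Algebra K Ω]
    {M : IntermediateField K Ω} {E : IntermediateField K M} (h : FiniteDimensional K E) :
    FiniteDimensional K (IntermediateField.lift E) :=
  Module.Finite.equiv (IntermediateField.liftAlgEquiv E).toLinearEquiv

/-! ### Generation by involutions outside Gal(L̃/K) -/

section Generation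

variable {Q : Type u} [Field Q] {vinf : Place Q} {K : IntermediateField Q (SeparableClosure Q)}
  {G : Type v} [Group G] [TopologicalSpace G] [DiscreteTopology G]

lemma finiteDimensional_fieldOf (ρ : GalUnram vinf K →ₜ* G) : FiniteDimensional K (fieldOf ρ) := by
  let H : ClosedSubgroup (GalUnram vinf K) :=
    ⟨MonoidHom.ker (ρ : GalUnram vinf K →* G), by
      have : IsClosed (ρ ⁻¹' {1}) := (isClosed_discrete _).preimage ρ.continuous_toFun
      exact this⟩
  have hopen : IsOpen H.1.carrier := by
    have : IsOpen (ρ ⁻¹' {1}) := (isOpen_discrete _).preimage ρ.continuous_toFun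
    exact this
  rw [← InfiniteGalois.fixingSubgroup_fixedField H, InfiniteGalois.isOpen_iff_finite] at hopen
  exact finiteDimensional_lift hopen

/-- If the local subgroups generate all Galois groups of finite Galois extensions of `Q` as normal
subgroups, then `Gal(L̃/Q)` is generated by its involutions outside of `Gal(L̃/K)`. -/
lemma closure_twists_eq_top (hK : Module.finrank Q K = 2) (ρ : GalUnram vinf K →ₜ* G)
    (hQ : ∀ (F : IntermediateField Q (SeparableClosure Q)) [FiniteDimensional Q F] [IsGalois Q F]
      (S : Subgroup Gal(F/Q)) [S.Normal], (∀ I ∈ localSubgroups vinf F, I ≤ S) → S = ⊤) :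
    Subgroup.closure {x : Gal(closureOf ρ/Q) | x ∉ kerSubgroup ρ ∧ orderOf x = 2} = ⊤ := by
  have : FiniteDimensional Q K := .of_finrank_pos (by omega)
  have := finiteDimensional_fieldOf ρ
  have hle : fieldOf ρ ≤ maxUnram vinf K := by
    unfold fieldOf
    exact IntermediateField.lift_le _
  obtain ⟨F, _, _, hLF', hF⟩ := exists_finite_galois_le (fun E hE => hE.1) hle
  have hLF : closureOf ρ ≤ F := IntermediateField.normalClosure_le_iff_of_normal.2 hLF'
  set T := {x : Gal(closureOf ρ/Q) | x ∉ kerSubgroup ρ ∧ orderOf x = 2} with hT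
  have hindex := kerSubgroup_index hK ρ
  have hker : (kerSubgroup ρ).Normal := Subgroup.normal_of_index_eq_two hindex
  have hTn : (Subgroup.closure T).Normal := by
    have hconj : Group.conjugatesOfSet T = T := by
      refine Set.Subset.antisymm (fun x hx => ?_) Group.subset_conjugatesOfSet
      obtain ⟨t, ⟨htK, ht⟩, hc⟩ := Group.mem_conjugatesOfSet_iff.1 hx
      obtain ⟨c, rfl⟩ := isConj_iff.1 hc
      refine ⟨fun h => htK ?_, ?_⟩
      · simpa [mul_assoc] using hker.conj_mem _ h c⁻¹
      · rw [← ht]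
        exact (MulAut.conj c).orderOf_eq t
    rw [← hconj]
    exact Subgroup.normalClosure_normal
  let rF := AlgEquiv.restrictNormalHom (F := Q) (K₁ := SeparableClosure Q) F
  let rL := AlgEquiv.restrictNormalHom (F := Q) (K₁ := SeparableClosure Q) (closureOf ρ)
  have hrF : Function.Surjective rF := AlgEquiv.restrictNormalHom_surjective _
  have hrL : Function.Surjective rL := AlgEquiv.restrictNormalHom_surjective _
  have key : ∀ g, ∀ I ∈ localSubgroups vinf F, rF g ∈ I → rL g ∈ kerSubgroup ρ → rL g = 1 := by
    intro g I hI hgI hgK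
    have hgL : g ∈ (closureOf ρ).fixingSubgroup := by
      -- `L̃` is generated by the conjugates `τ L`, and `g` fixes `τ L` once `τ⁻¹ * g * τ`, again in
      -- a local subgroup and trivial on `K`, fixes `L`.
      rw [← Subgroup.zpowers_le, ← IntermediateField.le_iff_le, closureOf,
        IntermediateField.normalClosure_def'']
      refine iSup_le fun τ => ?_
      rw [IntermediateField.le_iff_le, Subgroup.zpowers_le,
        IntermediateField.mem_fixingSubgroup_iff]
      rintro _ ⟨z, hz, rfl⟩
      obtain ⟨J, hJ, hgJ⟩ := exists_conj_mem_localSubgroups hI hgI (rF τ)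
      rw [← map_inv, ← map_mul, ← map_mul] at hgJ
      have hconj : rL (τ⁻¹ * g * τ) ∈ kerSubgroup ρ := by
        rw [map_mul, map_mul, map_inv]
        simpa using hker.conj_mem _ hgK (rL τ)⁻¹
      obtain ⟨h, hh⟩ : ∃ h : Gal(SeparableClosure Q/K), h.restrictScalars Q = τ⁻¹ * g * τ := by
        refine ⟨AlgEquiv.ofRingEquiv (f := (τ⁻¹ * g * τ).toRingEquiv) fun k => ?_, rfl⟩
        have h1 := AlgEquiv.restrictNormalHom_apply (closureOf ρ) (τ⁻¹ * g * τ)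
          ⟨k, base_le ρ k.2⟩
        have h2 := (IntermediateField.mem_fixingSubgroup_iff _ _).1 hconj ⟨k, base_le ρ k.2⟩
          ((IntermediateField.mem_restrict (base_le ρ) _).2 k.2)
        exact h1.symm.trans (congrArg Subtype.val h2)
      have h3 : h z = z := hF h (fun E hE hEF z hz =>
        apply_eq_self_of_mem_localSubgroups hE hEF hJ h (hh ▸ hgJ) hz) z hz
      have h4 : (τ⁻¹ * g * τ) z = z := by rw [← hh]; exact h3
      have h5 := congrArg τ h4
      rwa [← AlgEquiv.mul_apply, ← mul_assoc, ← mul_assoc, mul_inv_cancel, one_mul] at h5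
    refine AlgEquiv.ext fun z => Subtype.ext ?_
    rw [AlgEquiv.restrictNormalHom_apply]
    exact (IntermediateField.mem_fixingSubgroup_iff _ _).1 hgL z z.2
  have hmem : ∀ g, ∀ I ∈ localSubgroups vinf F, rF g ∈ I → rL g ∈ Subgroup.closure T := by
    intro g I hI hgI
    by_cases hgK : rL g ∈ kerSubgroup ρ
    · rw [key g I hI hgI hgK]
      exact one_mem _
    · refine Subgroup.subset_closure ⟨hgK, orderOf_eq_prime ?_ ?_⟩
      -- The square lies in the index-two subgroup and in the same local subgroup, so `key` makes it
      -- trivial.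
      · rw [← map_pow]
        refine key _ I hI (by rw [map_pow]; exact pow_mem hgI 2) ?_
        rw [map_pow]
        exact Subgroup.sq_mem_of_index_two hindex _
      · intro h
        exact hgK (h ▸ one_mem _)
  -- The generated subgroup is transported to `Gal(F/Q)` through the absolute Galois group. Nothing
  -- is lost, since elements agreeing on `F` agree on `L̃`.
  have hSn : (((Subgroup.closure T).comap rL).map rF).Normal :=
    (hTn.comap rL).map rF hrF
  have htop := hQ F (((Subgroup.closure T).comap rL).map rF) fun I hI σ hσ => by
    obtain ⟨g, rfl⟩ := hrF σ
    exact ⟨g, hmem g I hI hσ, rfl⟩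
  refine eq_top_iff.2 fun x _ => ?_
  obtain ⟨g, rfl⟩ := hrL x
  obtain ⟨h, hh, hgh⟩ : rF g ∈ ((Subgroup.closure T).comap rL).map rF := htop ▸ Subgroup.mem_top _
  have : rL g = rL h := AlgEquiv.ext fun z => Subtype.ext <| by
    rw [AlgEquiv.restrictNormalHom_apply, AlgEquiv.restrictNormalHom_apply]
    have := congrArg Subtype.val (DFunLike.congr_fun hgh ⟨z, hLF z.2⟩)
    rw [AlgEquiv.restrictNormalHom_apply, AlgEquiv.restrictNormalHom_apply] at this
    exact this.symm
  rw [this]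
  exact hh

end Generation

end QuadType

/-! ### The theorem for both base fields -/

open QuadType in
theorem propositionP {G : Type*} [Group G] [Finite G] [TopologicalSpace G] [DiscreteTopology G]
    (G' : Subgroup (Wreath G)) :
    (∀ winf : Place (SeparableClosure ℚ), winf.LiesOver ratInfty →
      ∀ (K : IntermediateField ℚ (SeparableClosure ℚ)) (hK : Module.finrank ℚ K = 2)
        (ρ : GalUnram ratInfty K →ₜ* G), Function.Surjective ρ →
        ((IsImaginaryRat K ∧ HasType winf hK ρ G') ∨
          (IsRealQuadratic ratInfty K ∧ ∃ y, PairHasType hK ρ y G')) →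
        IsAdmissible G') ∧
    (∀ (F : Type*) [Field F] [Finite F] (winf : Place (SeparableClosure (RatFunc F))),
      winf.LiesOver (ratFuncInfty F) →
      ∀ (K : IntermediateField (RatFunc F) (SeparableClosure (RatFunc F)))
        (hK : Module.finrank (RatFunc F) K = 2)
        (ρ : GalUnram (ratFuncInfty F) K →ₜ* G), Function.Surjective ρ →
        ((IsImaginaryRatFunc F K ∧ HasType winf hK ρ G') ∨
          (IsRealQuadratic (ratFuncInfty F) K ∧ ∃ y, PairHasType hK ρ y G')) →
        IsAdmissible G') := by
  refine ⟨fun winf _ K hK ρ hρ h => ?_, fun k _ _ winf _ K hK ρ hρ h => ?_⟩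
  · have hgen := closure_twists_eq_top hK ρ fun F _ _ S _ hS =>
      eq_top_of_inertiaGroup_le_rat S fun A hA => hS _ ⟨A, hA, .inl rfl⟩
    rcases h with ⟨_, y, _, _, h⟩ | ⟨_, y, h⟩ <;>
      exact isAdmissible_of_pairHasType hK ρ hρ hgen h
  · have hgen := closure_twists_eq_top hK ρ fun F _ _ S _ hS =>
      eq_top_of_inertiaGroup_le_ratFunc S (fun A hA => hS _ ⟨A, hA, .inl rfl⟩)
        fun A hA hv => hS _ ⟨A, hA, .inr ⟨hv, rfl⟩⟩
    rcases h with ⟨_, y, _, _, h⟩ | ⟨_, y, h⟩ <;>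
      exact isAdmissible_of_pairHasType hK ρ hρ hgen h
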